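/- Let $d\ge 2$ be a fixed integer, and let $B(x)\subset\mathbb{R}^d$, for $x\in\mathbb{R}^d$, denote one of the following: the open ball of radius $1$ centred at $x$, the closed ball of radius $1$ centred at $x$, the open axis-parallel cube of side length $1$ centred at $x$, or the closed axis-parallel cube of side length $1$ centred at $x$. There is an algorithm on a real RAM (exact arithmetic $+,-,\times,/$ and comparisons on real numbers and $+,-$ and comparisons on natural numbers at unit cost, unbounded indirectly addressed memory, no rounding) that, given $n\ge 0$ centres $c_1,\dots,c_n\in\mathbb{R}^d$ and an integer $k\ge 0$, decides in time $n^{O(k^{1-1/d})}$ whether there are $k$ pairwise nonintersecting ones among $B(c_1),\dots,B(c_n)$. Precisely, there are a program and a constant $C$, both depending only on $d$ and on which of the four bodies is considered, such that for all $n$, $k$ and $c_1,\dots,c_n$ the program halts with the correct answer after at most $C\cdot\max(n,1)^{C k^{1-1/d}}$ steps. -/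

import Mathlib

/-!
### The real random access machine

Programs of a real RAM, written as while-programs.  The memory consists of arrays of natural numbers
and arrays of real numbers, all unbounded and addressed indirectly: an index may be computed from
other cells.  An array is named by a numeral in the program text, so a program uses finitely many.
Natural numbers can be added, subtracted (truncated at `0`) and compared; real numbers can be added,
subtracted, multiplied, divided and compared exactly.  There is no rounding, and no way from real
numbers to natural numbers other than through comparisons.  Every operation, literal, memory access,
comparison and control step costs one unit of time.
-/

namespace RealRAM

/-- The memory: `nat a i` and `real a i` are the cells with index `i` of the arrays named `a`. -/
structure Memory where
  nat : ℕ → ℕ → ℕ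
  real : ℕ → ℕ → ℝ

/-- Expressions for natural numbers. -/
inductive NExpr where
  | lit (m : ℕ)
  | load (a : ℕ) (index : NExpr)
  | add (e f : NExpr)
  | sub (e f : NExpr)

/-- Expressions for real numbers; the only literals are rational. -/
inductive RExpr where
  | lit (q : ℚ)
  | load (a : ℕ) (index : NExpr)
  | add (e f : RExpr)
  | sub (e f : RExpr)
  | mul (e f : RExpr)
  | div (e f : RExpr)

/-- Tests. -/
inductive Test where
  | natLE (e f : NExpr)
  | natEq (e f : NExpr)
  | realLE (e f : RExpr)
  | realLT (e f : RExpr)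
  | not (b : Test)
  | and (b c : Test)

/-- Programs. -/
inductive Program where
  | skip
  | natStore (a : ℕ) (index : NExpr) (e : NExpr)
  | realStore (a : ℕ) (index : NExpr) (e : RExpr)
  | seq (p q : Program)
  | branch (b : Test) (p q : Program)
  | loop (b : Test) (p : Program)

namespace NExpr

def eval (s : Memory) : NExpr → ℕ
  | lit m => m
  | load a i => s.nat a (i.eval s)
  | add e f => e.eval s + f.eval s
  | sub e f => e.eval s - f.eval s

def cost : NExpr → ℕ
  | lit _ => 1
  | load _ i => i.cost + 1
  | add e f => e.cost + f.cost + 1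
  | sub e f => e.cost + f.cost + 1

end NExpr

namespace RExpr

noncomputable def eval (s : Memory) : RExpr → ℝ
  | lit q => (q : ℝ)
  | load a i => s.real a (i.eval s)
  | add e f => e.eval s + f.eval s
  | sub e f => e.eval s - f.eval s
  | mul e f => e.eval s * f.eval s
  | div e f => e.eval s / f.eval s

def cost : RExpr → ℕ
  | lit _ => 1
  | load _ i => i.cost + 1
  | add e f => e.cost + f.cost + 1
  | sub e f => e.cost + f.cost + 1
  | mul e f => e.cost + f.cost + 1
  | div e f => e.cost + f.cost + 1

end RExpr

namespace Test

def Holds (s : Memory) : Test → Prop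
  | natLE e f => e.eval s ≤ f.eval s
  | natEq e f => e.eval s = f.eval s
  | realLE e f => e.eval s ≤ f.eval s
  | realLT e f => e.eval s < f.eval s
  | not b => ¬ b.Holds s
  | and b c => b.Holds s ∧ c.Holds s

def cost : Test → ℕ
  | natLE e f => e.cost + f.cost + 1
  | natEq e f => e.cost + f.cost + 1
  | realLE e f => e.cost + f.cost + 1
  | realLT e f => e.cost + f.cost + 1
  | not b => b.cost + 1
  | and b c => b.cost + c.cost + 1

end Test

/-- The memory `s` after `v` has been written into cell `i` of the natural number array `a`. -/
def Memory.setNat (s : Memory) (a i v : ℕ) : Memory :=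
  { s with nat := Function.update s.nat a (Function.update (s.nat a) i v) }

/-- The memory `s` after `v` has been written into cell `i` of the real array `a`. -/
def Memory.setReal (s : Memory) (a i : ℕ) (v : ℝ) : Memory :=
  { s with real := Function.update s.real a (Function.update (s.real a) i v) }

/-- `Runs p s s' t`: started in memory `s`, the program `p` halts in memory `s'` after time `t`. -/
inductive Runs : Program → Memory → Memory → ℕ → Prop where
  | skip (s : Memory) : Runs .skip s s 1
  | natStore (s : Memory) (a : ℕ) (i e : NExpr) :
      Runs (.natStore a i e) s (s.setNat a (i.eval s) (e.eval s)) (i.cost + e.cost + 1)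
  | realStore (s : Memory) (a : ℕ) (i : NExpr) (e : RExpr) :
      Runs (.realStore a i e) s (s.setReal a (i.eval s) (e.eval s)) (i.cost + e.cost + 1)
  | seq {p q : Program} {s s' s'' : Memory} {t t' : ℕ} :
      Runs p s s' t → Runs q s' s'' t' → Runs (.seq p q) s s'' (t + t')
  | branchTrue {b : Test} {p q : Program} {s s' : Memory} {t : ℕ} :
      b.Holds s → Runs p s s' t → Runs (.branch b p q) s s' (b.cost + t + 1)
  | branchFalse {b : Test} {p q : Program} {s s' : Memory} {t : ℕ} :
      ¬ b.Holds s → Runs q s s' t → Runs (.branch b p q) s s' (b.cost + t + 1)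
  | loopDone {b : Test} {p : Program} {s : Memory} :
      ¬ b.Holds s → Runs (.loop b p) s s (b.cost + 1)
  | loopStep {b : Test} {p : Program} {s s' s'' : Memory} {t t' : ℕ} :
      b.Holds s → Runs p s s' t → Runs (.loop b p) s' s'' t' →
        Runs (.loop b p) s s'' (b.cost + t + t' + 1)

/-- The machine is deterministic: result and running time are determined by program and input. -/
theorem Runs.unique {p : Program} {s s₁ s₂ : Memory} {t₁ t₂ : ℕ}
    (h₁ : Runs p s s₁ t₁) (h₂ : Runs p s s₂ t₂) : s₁ = s₂ ∧ t₁ = t₂ := by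
  induction h₁ generalizing s₂ t₂ with
  | skip s => cases h₂; exact ⟨rfl, rfl⟩
  | natStore s a i e => cases h₂; exact ⟨rfl, rfl⟩
  | realStore s a i e => cases h₂; exact ⟨rfl, rfl⟩
  | seq _ _ ih ih' =>
    cases h₂ with
    | seq g g' =>
      obtain ⟨rfl, rfl⟩ := ih g
      obtain ⟨rfl, rfl⟩ := ih' g'
      exact ⟨rfl, rfl⟩
  | branchTrue hb _ ih =>
    cases h₂ with
    | branchTrue _ g => obtain ⟨rfl, rfl⟩ := ih g; exact ⟨rfl, rfl⟩
    | branchFalse hb' _ => exact absurd hb hb'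
  | branchFalse hb _ ih =>
    cases h₂ with
    | branchTrue hb' _ => exact absurd hb' hb
    | branchFalse _ g => obtain ⟨rfl, rfl⟩ := ih g; exact ⟨rfl, rfl⟩
  | loopDone hb =>
    cases h₂ with
    | loopDone _ => exact ⟨rfl, rfl⟩
    | loopStep hb' _ _ => exact absurd hb' hb
  | loopStep hb _ _ ih ih' =>
    cases h₂ with
    | loopDone hb' => exact absurd hb hb'
    | loopStep _ g g' =>
      obtain ⟨rfl, rfl⟩ := ih g
      obtain ⟨rfl, rfl⟩ := ih' g'
      exact ⟨rfl, rfl⟩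

end RealRAM

/-! ### Packing -/

namespace Packing

/-- The open axis-parallel cube of side length `1` centred at `x`. -/
def openCube {d : ℕ} (x : EuclideanSpace ℝ (Fin d)) : Set (EuclideanSpace ℝ (Fin d)) :=
  {y | ∀ j, |y j - x j| < 1 / 2}

/-- The closed axis-parallel cube of side length `1` centred at `x`. -/
def closedCube {d : ℕ} (x : EuclideanSpace ℝ (Fin d)) : Set (EuclideanSpace ℝ (Fin d)) :=
  {y | ∀ j, |y j - x j| ≤ 1 / 2}

/-- Among the bodies `B (c 0), …, B (c (n - 1))` there are `k` pairwise nonintersecting ones. -/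
def HasPacking {d n : ℕ} (B : EuclideanSpace ℝ (Fin d) → Set (EuclideanSpace ℝ (Fin d)))
    (c : Fin n → EuclideanSpace ℝ (Fin d)) (k : ℕ) : Prop :=
  ∃ S : Finset (Fin n), S.card = k ∧ (S : Set (Fin n)).PairwiseDisjoint (fun i => B (c i))

/-- The initial memory: cells `0` and `1` of the natural number array `0` hold `n` and `k`, cell `i`
of the real array `j` holds the `j`-th coordinate of the `i`-th centre, all else is `0`. -/
noncomputable def input {d n : ℕ} (c : Fin n → EuclideanSpace ℝ (Fin d)) (k : ℕ) :
    RealRAM.Memory where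
  nat a i := if a = 0 ∧ i = 0 then n else if a = 0 ∧ i = 1 then k else 0
  real j i := if h : j < d ∧ i < n then c ⟨i, h.2⟩ ⟨j, h.1⟩ else 0

/-- The output of a halting computation: cell `0` of the natural number array `0`. -/
def output (s : RealRAM.Memory) : ℕ := s.nat 0 0

end Packing

/-! ### Bounded formulas and their evaluation on the machine -/

namespace RealRAM

/-! The theorem rests on a separator property of packings. Take at most `k` points of which distinct
ones differ by more than `1 / d` in some coordinate. Either they extend by at least `5 ⌈k ^ (1 /
d)⌉` along some axis, and then an averaging argument gives a hyperplane orthogonal to that axis with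
`O(k ^ (1 - 1 / d))` points within distance `2`; or they all lie in a box with sides `O(k ^ (1 /
d))`, and then every axis-parallel slab of width `4` holds only that many by a volume count. In both
cases both sides of the cut are nonempty, and its position is a coordinate of a point plus `0` or
`3` (`exists_cut`).

Cutting repeatedly dissects a packing into single points, each in a box whose faces are such
hyperplanes. A cut replaces one face and takes points away from the others, so every face keeps few
points near it (`Fits.lowerPart`, `Fits.upperPart`). Bodies that meet have centres at most `2` apart
in each coordinate, so packings on the two sides of a cut are compatible as soon as their points
near the cut are. Hence about a partial packing only its size, its box and its points near the faces
need to be known: this is a fact.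

Facts are numbers below a bound `V` with `4 d + 1 + O(k ^ (1 - 1 / d))` digits in base `n + 3`, so
`V` is `n ^ O(k ^ (1 - 1 / d))`. The cuts need not be balanced: facts are tabulated, so the number
of possible facts matters, not the depth of the dissection. Joining valid facts gives valid facts
(`valid_of_joins`), and a packing of `k` points yields a fact derivable within `k` rounds
(`Complete.exists_fact`). So `k` rounds through all numbers up to `V` decide the question.

On the machine, one derivation step is a fixed first-order formula with quantifiers bounded by `V`;
`compile_runs` evaluates such formulas in time polynomial in `V`, which is again of the required
form (`pow_bound`). -/

/-- The scalar variable `a`: cell `0` of the natural number array `a`. -/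
abbrev NExpr.var (a : ℕ) : NExpr := .load a (.lit 0)

/-- All arrays read are below `D` and differ from the result register `1`. -/
def NExpr.Below (D : ℕ) : NExpr → Prop
  | lit _ => True
  | load a i => a < D ∧ a ≠ 1 ∧ i.Below D
  | add e f => e.Below D ∧ f.Below D
  | sub e f => e.Below D ∧ f.Below D

def RExpr.Below (D : ℕ) : RExpr → Prop
  | lit _ => True
  | load _ i => i.Below D
  | add e f => e.Below D ∧ f.Below D
  | sub e f => e.Below D ∧ f.Below D
  | mul e f => e.Below D ∧ f.Below D
  | div e f => e.Below D ∧ f.Below D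

def Test.Below (D : ℕ) : Test → Prop
  | natLE e f => e.Below D ∧ f.Below D
  | natEq e f => e.Below D ∧ f.Below D
  | realLE e f => e.Below D ∧ f.Below D
  | realLT e f => e.Below D ∧ f.Below D
  | not b => b.Below D
  | and b c => b.Below D ∧ c.Below D

/-- The memories agree except for the scalar variables from `D` on and the result register. -/
structure Agree (D : ℕ) (s s' : Memory) : Prop where
  real : s'.real = s.real
  cell : ∀ a i, a ≠ 1 → (a < D ∨ i ≠ 0) → s'.nat a i = s.nat a i

theorem Agree.nat {D : ℕ} {s s' : Memory} (h : Agree D s s') (a : ℕ) (ha : a < D) (h1 : a ≠ 1) :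
    s'.nat a = s.nat a :=
  funext fun i => h.cell a i h1 (.inl ha)

theorem Agree.refl (D : ℕ) (s : Memory) : Agree D s s := ⟨rfl, fun _ _ _ _ => rfl⟩

theorem Memory.setNat_nat_same (s : Memory) (a i v : ℕ) :
    (s.setNat a i v).nat a = Function.update (s.nat a) i v := by simp [Memory.setNat]

theorem Memory.setNat_nat_ne (s : Memory) {a b : ℕ} (i v : ℕ) (h : b ≠ a) :
    (s.setNat a i v).nat b = s.nat b := by simp [Memory.setNat, h]

@[simp] theorem Memory.setNat_real (s : Memory) (a i v : ℕ) :
    (s.setNat a i v).real = s.real := rfl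

@[simp] theorem Memory.setReal_nat (s : Memory) (a i : ℕ) (v : ℝ) :
    (s.setReal a i v).nat = s.nat := rfl

theorem Memory.setNat_nat (s : Memory) (a i v b j : ℕ) :
    (s.setNat a i v).nat b j = if b = a ∧ j = i then v else s.nat b j := by
  by_cases h : b = a
  · subst h; by_cases h' : j = i <;> simp [Memory.setNat, h']
  · simp [Memory.setNat, h]

theorem Memory.setReal_real (s : Memory) (a i : ℕ) (v : ℝ) (b j : ℕ) :
    (s.setReal a i v).real b j = if b = a ∧ j = i then v else s.real b j := by
  by_cases h : b = a
  · subst h; by_cases h' : j = i <;> simp [Memory.setReal, h']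
  · simp [Memory.setReal, h]

theorem Agree.setNat {D : ℕ} {s s' : Memory} (h : Agree D s s') {a : ℕ} (v : ℕ)
    (ha : D ≤ a ∨ a = 1) : Agree D s (s'.setNat a 0 v) :=
  ⟨h.real, fun b j h1 hb => by
    rw [Memory.setNat_nat, if_neg (by omega)]; exact h.cell b j h1 hb⟩

/-- The variable bound at level `D` is invisible at level `D`, so the evaluation of a quantifier may
leave anything in it. -/
theorem Agree.of_setNat {D : ℕ} {s s' : Memory} {v : ℕ}
    (h : Agree (D + 1) (s.setNat D 0 v) s') : Agree D s s' :=
  ⟨h.real, fun b j h1 hb => by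
    rw [h.cell b j h1 (by omega), Memory.setNat_nat, if_neg (by omega)]⟩

theorem Agree.setNat_succ {D : ℕ} {s s' : Memory} (h : Agree D s s') (v : ℕ) :
    Agree (D + 1) (s.setNat D 0 v) (s'.setNat D 0 v) := by
  refine ⟨h.real, fun b j h1 hb => ?_⟩
  rw [Memory.setNat_nat, Memory.setNat_nat]
  split_ifs with hc
  · rfl
  · exact h.cell b j h1 (by omega)

theorem NExpr.eval_congr {D : ℕ} {s s' : Memory} (h : Agree D s s') :
    ∀ e : NExpr, e.Below D → e.eval s' = e.eval s
  | lit _, _ => rfl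
  | load a i, hb => by
    simp only [eval, h.nat a hb.1 hb.2.1, NExpr.eval_congr h i hb.2.2]
  | add e f, hb => by
    simp only [eval, NExpr.eval_congr h e hb.1, NExpr.eval_congr h f hb.2]
  | sub e f, hb => by
    simp only [eval, NExpr.eval_congr h e hb.1, NExpr.eval_congr h f hb.2]

theorem RExpr.eval_congr {D : ℕ} {s s' : Memory} (h : Agree D s s') :
    ∀ e : RExpr, e.Below D → e.eval s' = e.eval s
  | lit _, _ => rfl
  | load a i, hb => by simp only [eval, h.real, NExpr.eval_congr h i hb]
  | add e f, hb | sub e f, hb | mul e f, hb | div e f, hb => by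
    simp only [eval, RExpr.eval_congr h e hb.1, RExpr.eval_congr h f hb.2]

theorem Test.holds_congr {D : ℕ} {s s' : Memory} (h : Agree D s s') :
    ∀ b : Test, b.Below D → (b.Holds s' ↔ b.Holds s)
  | natLE e f, hb | natEq e f, hb => by
    simp only [Holds, NExpr.eval_congr h e hb.1, NExpr.eval_congr h f hb.2]
  | realLE e f, hb | realLT e f, hb => by
    simp only [Holds, RExpr.eval_congr h e hb.1, RExpr.eval_congr h f hb.2]
  | not b, hb => by simp only [Holds, Test.holds_congr h b hb]
  | and b c, hb => by
    simp only [Holds, Test.holds_congr h b hb.1, Test.holds_congr h c hb.2]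

/-! ### Formulas with quantifiers along decreasing chains -/

/-- `Chain nx v w`: the nonzero number `w` is met on iterating `nx` from `v`, before `0` is. -/
inductive Chain (nx : ℕ → ℕ) : ℕ → ℕ → Prop
  | here {v : ℕ} : v ≠ 0 → Chain nx v v
  | next {v w : ℕ} : v ≠ 0 → Chain nx (nx v) w → Chain nx v w

theorem Chain.not_zero {nx : ℕ → ℕ} {w : ℕ} : ¬ Chain nx 0 w := by
  intro h
  cases h with
  | here h => exact h rfl
  | next h _ => exact h rfl

theorem Chain.iff_of_ne_zero {nx : ℕ → ℕ} {v w : ℕ} (hv : v ≠ 0) :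
    Chain nx v w ↔ w = v ∨ Chain nx (nx v) w := by
  constructor
  · intro h
    cases h with
    | here _ => exact .inl rfl
    | next _ h => exact .inr h
  · rintro (rfl | h)
    · exact .here hv
    · exact .next hv h

theorem Chain.pred_iff {v w : ℕ} : Chain (fun i => i - 1) v w ↔ 1 ≤ w ∧ w ≤ v := by
  induction v with
  | zero => exact ⟨fun h => absurd h Chain.not_zero, by omega⟩
  | succ v ih => rw [Chain.iff_of_ne_zero (by omega), Nat.add_sub_cancel, ih]; omega

/-- Formulas over tests, with quantifiers that run along `i, i - 1, …, 1` or along the chain of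
table `3`.  A quantifier at level `D` binds the scalar variable `D`. -/
inductive Formula where
  | test (b : Test)
  | not (φ : Formula)
  | and (φ ψ : Formula)
  | all (table : Bool) (start : NExpr) (φ : Formula)

namespace Formula

/-- The step of a quantifier. -/
def step (table : Bool) (s : Memory) (v : ℕ) : ℕ := if table then s.nat 3 v else v - 1

def stepExpr (table : Bool) (D : ℕ) : NExpr :=
  if table then .load 3 (.var D) else .sub (.var D) (.lit 1)

def Holds (D : ℕ) (s : Memory) : Formula → Prop
  | test b => b.Holds s
  | not φ => ¬ φ.Holds D s
  | and φ ψ => φ.Holds D s ∧ ψ.Holds D s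
  | all t e φ => ∀ w, Chain (step t s) (e.eval s) w → φ.Holds (D + 1) (s.setNat D 0 w)

def Below (D : ℕ) : Formula → Prop
  | test b => b.Below D
  | not φ => φ.Below D
  | and φ ψ => φ.Below D ∧ ψ.Below D
  | all _ e φ => e.Below D ∧ φ.Below (D + 1)

/-- All quantifiers start at numbers up to `V`. -/
def Bounded (V D : ℕ) (s : Memory) : Formula → Prop
  | test _ => True
  | not φ => φ.Bounded V D s
  | and φ ψ => φ.Bounded V D s ∧ ψ.Bounded V D s
  | all _ e φ => e.eval s ≤ V ∧ ∀ w ≤ V, φ.Bounded V (D + 1) (s.setNat D 0 w)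

/-- The program that evaluates a formula into the result register. -/
def compile (D : ℕ) : Formula → Program
  | test b => .branch b (.natStore 1 (.lit 0) (.lit 1)) (.natStore 1 (.lit 0) (.lit 0))
  | not φ => .seq (φ.compile D) (.natStore 1 (.lit 0) (.sub (.lit 1) (.var 1)))
  | and φ ψ => .seq (φ.compile D) (.branch (.natEq (.var 1) (.lit 1)) (ψ.compile D) .skip)
  | all t e φ =>
    .seq (.natStore D (.lit 0) e) <| .seq (.natStore 1 (.lit 0) (.lit 1)) <|
      .loop (.and (.not (.natEq (.var D) (.lit 0))) (.natEq (.var 1) (.lit 1)))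
        (.seq (φ.compile (D + 1)) (.natStore D (.lit 0) (stepExpr t D)))

/-- Chains descend strictly, so a quantifier starting at most at `V` runs its body at most `V`
times; the other constants count the instructions around the body. -/
def costBound (V : ℕ) : Formula → ℕ
  | test b => b.cost + 4
  | not φ => φ.costBound V + 6
  | and φ ψ => φ.costBound V + ψ.costBound V + 6
  | all _ e φ => e.cost + 16 + V * (φ.costBound V + 17)

/-- Each quantifier contributes one factor `V + 1`. The formula is fixed, so the exponent does not
depend on the input. -/
theorem costBound_poly (φ : Formula) : ∃ A m : ℕ, ∀ V, φ.costBound V ≤ A * (V + 1) ^ m := by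
  induction φ with
  | test b => exact ⟨b.cost + 4, 0, fun V => by simp [costBound]⟩
  | not φ ih =>
    obtain ⟨A, m, h⟩ := ih
    refine ⟨A + 6, m, fun V => ?_⟩
    have := h V
    have h1 : 1 ≤ (V + 1) ^ m := Nat.one_le_pow _ _ (by omega)
    simp only [costBound]
    nlinarith
  | and φ ψ ih ih' =>
    obtain ⟨A, m, h⟩ := ih
    obtain ⟨A', m', h'⟩ := ih'
    refine ⟨A + A' + 6, m + m', fun V => ?_⟩
    have h1 : (V + 1) ^ m ≤ (V + 1) ^ (m + m') := Nat.pow_le_pow_right (by omega) (by omega)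
    have h2 : (V + 1) ^ m' ≤ (V + 1) ^ (m + m') := Nat.pow_le_pow_right (by omega) (by omega)
    have h3 : 1 ≤ (V + 1) ^ (m + m') := Nat.one_le_pow _ _ (by omega)
    have h4 := (h V).trans (Nat.mul_le_mul_left A h1)
    have h5 := (h' V).trans (Nat.mul_le_mul_left A' h2)
    simp only [costBound]
    linarith
  | all t e φ ih =>
    obtain ⟨A, m, h⟩ := ih
    refine ⟨e.cost + 16 + (A + 17), m + 1, fun V => ?_⟩
    have h1 : 1 ≤ (V + 1) ^ m := Nat.one_le_pow _ _ (by omega)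
    have h3 : 1 ≤ (V + 1) ^ (m + 1) := Nat.one_le_pow _ _ (by omega)
    have h4 : φ.costBound V + 17 ≤ (A + 17) * (V + 1) ^ m := by linarith [h V]
    have h5 : V * (φ.costBound V + 17) ≤ (V + 1) * ((A + 17) * (V + 1) ^ m) :=
      Nat.mul_le_mul (by omega) h4
    have h6 : (V + 1) * ((A + 17) * (V + 1) ^ m) = (A + 17) * (V + 1) ^ (m + 1) := by ring
    have h7 : (e.cost + 16) * 1 ≤ (e.cost + 16) * (V + 1) ^ (m + 1) := Nat.mul_le_mul_left _ h3
    simp only [costBound]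
    linarith

theorem step_lt {s : Memory} (h3 : ∀ v, v ≠ 0 → s.nat 3 v < v) (t : Bool) (v : ℕ) (hv : v ≠ 0) :
    step t s v < v := by
  cases t
  · simp only [step]; simp; omega
  · simpa [step] using h3 v hv

theorem stepExpr_eval {t : Bool} {D : ℕ} {s s₀ : Memory} {v : ℕ} (hD : 4 ≤ D)
    (h : Agree (D + 1) (s₀.setNat D 0 v) s) : (stepExpr t D).eval s = step t s₀ v := by
  have hv : s.nat D 0 = v := by
    rw [h.nat D (by omega) (by omega), Memory.setNat_nat_same]; simp
  have h3 : s.nat 3 = s₀.nat 3 := h.of_setNat.nat 3 (by omega) (by omega)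
  cases t <;> simp [stepExpr, step, NExpr.eval, hv, h3]

theorem stepExpr_cost (t : Bool) (D : ℕ) : (stepExpr t D).cost ≤ 4 := by
  cases t <;> simp [stepExpr, NExpr.cost]

-- Strong induction on the current value `v`: the next one is smaller, both for the predecessor and
-- for the table. Register `1` carries the truth of the conjunction so far, and the loop stops once
-- it is `0`.
open Classical in
theorem loop_runs {D V T : ℕ} {s₀ : Memory} {t : Bool} {φ : Formula} (hD : 4 ≤ D)
    (h3 : ∀ v, v ≠ 0 → s₀.nat 3 v < v)
    (hφ : ∀ v ≤ V, ∀ s, Agree (D + 1) (s₀.setNat D 0 v) s → ∃ s' τ,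
      Runs (φ.compile (D + 1)) s s' τ ∧ τ ≤ T ∧ Agree (D + 1) (s₀.setNat D 0 v) s' ∧
        s'.nat 1 0 = if φ.Holds (D + 1) (s₀.setNat D 0 v) then 1 else 0) :
    ∀ v ≤ V, ∀ s, Agree (D + 1) (s₀.setNat D 0 v) s → (s.nat 1 0 = 0 ∨ s.nat 1 0 = 1) →
      ∃ s' τ, Runs (.loop (.and (.not (.natEq (.var D) (.lit 0))) (.natEq (.var 1) (.lit 1)))
        (.seq (φ.compile (D + 1)) (.natStore D (.lit 0) (stepExpr t D)))) s s' τ ∧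
        τ ≤ 11 + v * (T + 17) ∧ Agree D s₀ s' ∧
        s'.nat 1 0 = if s.nat 1 0 = 1 ∧ ∀ w, Chain (step t s₀) v w →
          φ.Holds (D + 1) (s₀.setNat D 0 w) then 1 else 0 := by
  intro v
  induction v using Nat.strong_induction_on with
  | _ v ih =>
  intro hvV s hs h01
  have hv : s.nat D 0 = v := by
    rw [hs.nat D (by omega) (by omega), Memory.setNat_nat_same]; simp
  by_cases hb : v ≠ 0 ∧ s.nat 1 0 = 1
  · obtain ⟨s', τ, hr, hτ, ha, h1⟩ := hφ v hvV s hs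
    set u := step t s₀ v with hu
    have huv : u < v := step_lt h3 t v hb.1
    have he : (stepExpr t D).eval s' = u := stepExpr_eval hD ha
    have hs2 : Agree (D + 1) (s₀.setNat D 0 u) (s'.setNat D 0 u) := ha.of_setNat.setNat_succ u
    have hone : (s'.setNat D 0 u).nat 1 0 = s'.nat 1 0 := by
      rw [Memory.setNat_nat_ne _ _ _ (by omega)]
    obtain ⟨s'', τ', hr', hτ', ha', h1'⟩ := ih u huv (by omega) _ hs2 (by
      rw [hone, h1]; split_ifs <;> simp)
    refine ⟨s'', _, Runs.loopStep (t' := τ') ?_ (Runs.seq hr (Runs.natStore _ _ _ _)) ?_,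
      ?_, ha', ?_⟩
    · simpa [Test.Holds, NExpr.eval, hv] using hb
    · rw [he]; simpa [NExpr.eval] using hr'
    · have h5 : (u + 1) * (T + 17) ≤ v * (T + 17) := Nat.mul_le_mul_right _ huv
      have := stepExpr_cost t D
      simp only [Test.cost, NExpr.cost]
      have h6 : (u + 1) * (T + 17) = u * (T + 17) + (T + 17) := by ring
      omega
    · rw [h1', hone, h1]
      congr 1
      rw [hb.2]
      simp only [Chain.iff_of_ne_zero hb.1, ← hu]
      by_cases hh : φ.Holds (D + 1) (s₀.setNat D 0 v)
      · simp [hh]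
      · simp only [hh, if_false]
        simp
        exact fun h => absurd h hh
  · refine ⟨s, _, Runs.loopDone ?_, ?_, hs.of_setNat, ?_⟩
    · simpa [Test.Holds, NExpr.eval, hv] using hb
    · simp [Test.cost, NExpr.cost]
    · by_cases h1 : s.nat 1 0 = 1
      · have : v = 0 := by tauto
        subst this
        simp [h1, Chain.not_zero]
      · have : s.nat 1 0 = 0 := by tauto
        simp [this]

-- The meaning is fixed in a reference memory `s₀` while the program starts in any `s` that agrees
-- with it; this lets the induction pass over scratch values left by subformulas evaluated before.
open Classical in
theorem compile_runs {V : ℕ} (φ : Formula) : ∀ (D : ℕ) (s₀ : Memory), 4 ≤ D → φ.Below D →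
    (∀ v, v ≠ 0 → s₀.nat 3 v < v) → φ.Bounded V D s₀ → ∀ s, Agree D s₀ s →
    ∃ s' t, Runs (φ.compile D) s s' t ∧ t ≤ φ.costBound V ∧ Agree D s₀ s' ∧
      s'.nat 1 0 = if φ.Holds D s₀ then 1 else 0 := by
  induction φ with
  | test b =>
    intro D s₀ hD hb h3 _ s hs
    by_cases h : b.Holds s
    · refine ⟨_, _, Runs.branchTrue h (Runs.natStore _ _ _ _), ?_, hs.setNat _ (.inr rfl), ?_⟩
      · simp [costBound, NExpr.cost]
      · rw [Memory.setNat_nat_same]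
        simp [NExpr.eval, Holds, (Test.holds_congr hs b hb).1 h]
    · refine ⟨_, _, Runs.branchFalse h (Runs.natStore _ _ _ _), ?_, hs.setNat _ (.inr rfl), ?_⟩
      · simp [costBound, NExpr.cost]
      · rw [Memory.setNat_nat_same]
        simp [NExpr.eval, Holds, mt (Test.holds_congr hs b hb).2 h]
  | not φ ih =>
    intro D s₀ hD hb h3 hV s hs
    obtain ⟨s', t, hr, ht, ha, h1⟩ := ih D s₀ hD hb h3 hV s hs
    refine ⟨_, _, Runs.seq hr (Runs.natStore _ _ _ _), ?_, ha.setNat _ (.inr rfl), ?_⟩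
    · simp [costBound, NExpr.cost]; omega
    · rw [Memory.setNat_nat_same]
      by_cases h : φ.Holds D s₀ <;> simp [NExpr.eval, Holds, h1, h]
  | and φ ψ ih ih' =>
    intro D s₀ hD hb h3 hV s hs
    obtain ⟨s', t, hr, ht, ha, h1⟩ := ih D s₀ hD hb.1 h3 hV.1 s hs
    by_cases h : φ.Holds D s₀
    · obtain ⟨s'', t', hr', ht', ha', h1'⟩ := ih' D s₀ hD hb.2 h3 hV.2 s' ha
      refine ⟨s'', _, Runs.seq hr (Runs.branchTrue ?_ hr'), ?_, ha', ?_⟩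
      · simp [Test.Holds, NExpr.eval, h1, h]
      · simp [costBound, Test.cost, NExpr.cost]; omega
      · simp [Holds, h1', h]
    · refine ⟨s', _, Runs.seq hr (Runs.branchFalse ?_ (Runs.skip _)), ?_, ha, ?_⟩
      · simp [Test.Holds, NExpr.eval, h1, h]
      · simp [costBound, Test.cost, NExpr.cost]; omega
      · simp [Holds, h1, h]
  | all t e φ ih =>
    intro D s₀ hD hb h3 hV s hs
    set v := e.eval s₀ with hv
    have he : e.eval s = v := NExpr.eval_congr hs e hb.1
    have h3' : ∀ w v, v ≠ 0 → (s₀.setNat D 0 w).nat 3 v < v := fun w v => by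
      rw [Memory.setNat_nat_ne _ _ _ (by omega)]; exact h3 v
    have hr1 := Runs.natStore s D (.lit 0) e
    rw [he] at hr1
    set s₁ := s.setNat D 0 v with hs₁
    have hr2 := Runs.natStore s₁ 1 (.lit 0) (.lit 1)
    have ha2 : Agree (D + 1) (s₀.setNat D 0 v) (s₁.setNat 1 0 1) :=
      (hs.setNat_succ v).setNat _ (.inr rfl)
    have h1 : (s₁.setNat 1 0 1).nat 1 0 = 1 := by simp [Memory.setNat_nat]
    obtain ⟨s', τ, hr, hτ, ha, h⟩ := loop_runs (t := t) (T := φ.costBound V) (φ := φ) (V := V) hD h3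
      (fun w hw s hs => ih (D + 1) (s₀.setNat D 0 w) (by omega) hb.2 (h3' w) (hV.2 w hw) s hs)
      v hV.1 _ ha2 (.inr h1)
    refine ⟨s', _, Runs.seq hr1 (Runs.seq hr2 hr), ?_, ha, ?_⟩
    · have h5 : v * (φ.costBound V + 17) ≤ V * (φ.costBound V + 17) :=
        Nat.mul_le_mul_right _ hV.1
      simp only [costBound, NExpr.cost]
      omega
    · rw [h, h1]
      simp only [true_and]
      rfl

end Formula

/-- A loop that keeps an invariant `I i` and ends after `m` rounds. -/
theorem Runs.loop_count {b : Test} {p : Program} {m T : ℕ} (I : ℕ → Memory → Prop)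
    (hstep : ∀ i < m, ∀ s, I i s → b.Holds s ∧ ∃ s' t, Runs p s s' t ∧ t ≤ T ∧ I (i + 1) s')
    (hend : ∀ s, I m s → ¬ b.Holds s) {s : Memory} (h0 : I 0 s) :
    ∃ s' t, Runs (.loop b p) s s' t ∧ t ≤ m * (T + b.cost + 1) + (b.cost + 1) ∧ I m s' := by
  have key : ∀ r i, i + r = m → ∀ s, I i s → ∃ s' t, Runs (.loop b p) s s' t ∧
      t ≤ r * (T + b.cost + 1) + (b.cost + 1) ∧ I m s' := by
    intro r
    induction r with
    | zero =>
      intro i hi s hs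
      obtain rfl : i = m := by omega
      exact ⟨s, _, .loopDone (hend s hs), by omega, hs⟩
    | succ r ih =>
      intro i hi s hs
      obtain ⟨hb, s', t, hr, ht, hs'⟩ := hstep i (by omega) s hs
      obtain ⟨s'', t', hr', ht', hs''⟩ := ih (i + 1) (by omega) s' hs'
      refine ⟨s'', _, .loopStep hb hr hr', ?_, hs''⟩
      rw [Nat.succ_mul]
      omega
  exact key m 0 (by omega) s h0

end RealRAM

/-! ### Cutting a packing by an axis-parallel hyperplane -/

namespace Packing

open Finset

/-- Points indexed by `p` have the coordinates `x p j`, `j < d`; distinct ones in `S` are more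
than `1 / d` apart in some coordinate. -/
def Separated (d : ℕ) (x : ℕ → ℕ → ℝ) (S : Finset ℕ) : Prop :=
  ∀ p ∈ S, ∀ q ∈ S, p ≠ q → ∃ j < d, 1 / (d : ℝ) < |x p j - x q j|

theorem Separated.mono {d : ℕ} {x : ℕ → ℕ → ℝ} {S T : Finset ℕ} (h : Separated d x S)
    (hT : T ⊆ S) : Separated d x T :=
  fun p hp q hq => h p (hT hp) q (hT hq)

/-- Pigeonhole on a grid of mesh `1 / d`: two points in the same cell would differ by less than `1 /
d` in every coordinate. -/
theorem Separated.card_le_of_box {d : ℕ} (hd : 0 < d) {x : ℕ → ℕ → ℝ} {T : Finset ℕ}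
    (hT : Separated d x T) (lo : ℕ → ℝ) (w : ℕ → ℕ)
    (hbox : ∀ p ∈ T, ∀ j < d, lo j ≤ x p j ∧ x p j ≤ lo j + w j) :
    T.card ≤ ∏ j ∈ range d, (w j * d + 1) := by
  have hd' : (0 : ℝ) < d := by exact_mod_cast hd
  let g : ℕ → Fin d → ℕ := fun p j => ⌊(x p j - lo j) * d⌋₊
  have hmaps : ∀ p ∈ T, g p ∈ Fintype.piFinset fun j : Fin d => range (w j * d + 1) := by
    intro p hp
    rw [Fintype.mem_piFinset]
    intro j
    obtain ⟨_, h2⟩ := hbox p hp j j.2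
    rw [mem_range, Nat.lt_succ_iff]
    refine Nat.floor_le_of_le ?_
    push_cast
    exact mul_le_mul_of_nonneg_right (by linarith) hd'.le
  have hinj : Set.InjOn g T := by
    intro p hp q hq hpq
    by_contra hne
    obtain ⟨j, hj, hlt⟩ := hT p hp q hq hne
    have hf : ⌊(x p j - lo j) * d⌋₊ = ⌊(x q j - lo j) * d⌋₊ := congrFun hpq ⟨j, hj⟩
    have hp0 : 0 ≤ (x p j - lo j) * d := mul_nonneg (by linarith [(hbox p hp j hj).1]) hd'.le
    have hq0 : 0 ≤ (x q j - lo j) * d := mul_nonneg (by linarith [(hbox q hq j hj).1]) hd'.le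
    have h1 := Nat.floor_le hp0
    have h2 := Nat.lt_floor_add_one ((x p j - lo j) * d)
    have h3 := Nat.floor_le hq0
    have h4 := Nat.lt_floor_add_one ((x q j - lo j) * d)
    rw [hf] at h1 h2
    have h5 : |x p j - x q j| * d < 1 := by
      have h6 : |x p j - x q j| * d = |(x p j - x q j) * d| := by rw [abs_mul, abs_of_pos hd']
      rw [h6, abs_lt]
      constructor <;> nlinarith
    rw [div_lt_iff₀ hd'] at hlt
    linarith
  calc T.card ≤ (Fintype.piFinset fun j : Fin d => range (w j * d + 1)).card :=
        card_le_card_of_injOn g hmaps hinj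
    _ = ∏ j ∈ range d, (w j * d + 1) := by
        rw [Fintype.card_piFinset, ← Fin.prod_univ_eq_prod_range (fun j => w j * d + 1)]
        simp

/-- A bound, up to the factor `k ^ (1 - 1 / d)`, for the number of points near a good cut. -/
def cutConst (d : ℕ) : ℕ := (4 * d + 1) * (11 * d) ^ (d - 1)

theorem rpow_dim_mul {d k : ℕ} (hk : 0 < k) :
    (k : ℝ) ^ (1 / (d : ℝ)) * (k : ℝ) ^ (1 - 1 / (d : ℝ)) = k := by
  rw [← Real.rpow_add (by exact_mod_cast hk)]
  simp

theorem rpow_dim_pow {d k : ℕ} (hd : 0 < d) :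
    ((k : ℝ) ^ (1 / (d : ℝ))) ^ (d - 1) = (k : ℝ) ^ (1 - 1 / (d : ℝ)) := by
  have hd' : (d : ℝ) ≠ 0 := by exact_mod_cast hd.ne'
  rw [← Real.rpow_natCast, ← Real.rpow_mul (by positivity), Nat.cast_sub hd]
  congr 1
  field_simp
  simp

/-- The points of `S` in the slab around the hyperplane `x j = τ`. -/
noncomputable def slab (x : ℕ → ℕ → ℝ) (S : Finset ℕ) (j : ℕ) (τ : ℝ) : Finset ℕ :=
  S.filter fun a => τ - 2 ≤ x a j ∧ x a j < τ + 2

/-- Among `A` disjoint open intervals of length `5` between `a` and `b`, one has at most the average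
number of points. The cut is placed `3` after the last point `p` before that interval. The slab then
starts `1` beyond `p` and ends before the interval does, so its points all lie in the interval. -/
theorem exists_cut_of_long {x : ℕ → ℕ → ℝ} {S : Finset ℕ} {j A : ℕ} {K : ℝ} (hA : 0 < A)
    (hcard : (S.card : ℝ) ≤ A * K) {a b : ℕ} (ha : a ∈ S) (hb : b ∈ S)
    (hab : 5 * (A : ℝ) ≤ x b j - x a j) :
    ∃ p ∈ S, (∃ u ∈ S, x u j < x p j + 3) ∧ (∃ u ∈ S, x p j + 3 ≤ x u j) ∧
      ((slab x S j (x p j + 3)).card : ℝ) ≤ K := by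
  classical
  let U : ℕ → Finset ℕ := fun i =>
    S.filter fun u => x a j + 5 * i < x u j ∧ x u j < x a j + 5 * i + 5
  have hdisj : ∀ i ∈ range A, ∀ i' ∈ range A, i ≠ i' → Disjoint (U i) (U i') := by
    have aux : ∀ i i' : ℕ, i < i' → Disjoint (U i) (U i') := by
      intro i i' hlt
      rw [Finset.disjoint_left]
      intro u hu hu'
      have h1 := (mem_filter.1 hu).2.2
      have h2 := (mem_filter.1 hu').2.1
      have h3 : (i : ℝ) + 1 ≤ i' := by exact_mod_cast hlt
      linarith
    intro i _ i' _ hne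
    rcases lt_or_gt_of_ne hne with h | h
    · exact aux i i' h
    · exact (aux i' i h).symm
  obtain ⟨i, hi, hiK⟩ : ∃ i ∈ range A, ((U i).card : ℝ) ≤ K := by
    by_contra! hcon
    have hne : (range A).Nonempty := ⟨0, by simpa using hA⟩
    have h1 : ∑ i ∈ range A, K < ∑ i ∈ range A, ((U i).card : ℝ) := sum_lt_sum_of_nonempty hne hcon
    have h2 : ((range A).biUnion U).card = ∑ i ∈ range A, (U i).card := card_biUnion hdisj
    have h3 : ((range A).biUnion U).card ≤ S.card :=
      card_le_card (biUnion_subset.2 fun i _ => filter_subset _ _)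
    rw [h2] at h3
    have h4 : ∑ i ∈ range A, ((U i).card : ℝ) ≤ S.card := by exact_mod_cast h3
    rw [sum_const, card_range, nsmul_eq_mul] at h1
    linarith
  have hiA : (i : ℝ) + 1 ≤ A := by exact_mod_cast mem_range.1 hi
  -- Anchoring the cut at a point of `S`, and not at an end of the interval, lets a point index and
  -- a shift describe it.
  obtain ⟨p, hp, hpmax⟩ := exists_max_image (S.filter fun u => x u j ≤ x a j + 5 * i)
    (fun u => x u j) ⟨a, by simp [ha]⟩
  rw [mem_filter] at hp
  refine ⟨p, hp.1, ⟨p, hp.1, by linarith⟩, ⟨b, hb, by linarith [hp.2]⟩, le_trans ?_ hiK⟩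
  norm_cast
  refine card_le_card fun u hu => ?_
  obtain ⟨huS, h1, h2⟩ := mem_filter.1 hu
  refine mem_filter.2 ⟨huS, ?_, by linarith [hp.2]⟩
  by_contra! hle
  linarith [hpmax u (mem_filter.2 ⟨huS, hle⟩)]

/-- The points of the slab lie in a box with one side `4` and all others `5 * A`, to which the
packing bound applies. -/
theorem slab_card_le_of_short {d : ℕ} (hd : 0 < d) {x : ℕ → ℕ → ℝ} {S : Finset ℕ}
    (hS : Separated d x S) {A : ℕ}
    (hshort : ∀ j < d, ∀ a ∈ S, ∀ b ∈ S, x b j - x a j < 5 * (A : ℝ)) {j : ℕ} (hj : j < d)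
    (τ : ℝ) : (slab x S j τ).card ≤ (4 * d + 1) * (5 * A * d + 1) ^ (d - 1) := by
  classical
  rcases S.eq_empty_or_nonempty with rfl | hne
  · simp [slab]
  choose m hm hmin using fun i => exists_min_image S (fun u => x u i) hne
  have h := (hS.mono (filter_subset _ _ : slab x S j τ ⊆ S)).card_le_of_box hd
    (fun i => if i = j then τ - 2 else x (m i) i) (fun i => if i = j then 4 else 5 * A) (by
      intro p hp i hi
      obtain ⟨hpS, h1, h2⟩ := mem_filter.1 hp
      by_cases hij : i = j
      · subst hij
        simp only [if_true]
        push_cast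
        constructor <;> linarith
      · simp only [hij, if_false]
        push_cast
        exact ⟨hmin i p hpS, by linarith [hshort i hi (m i) (hm i) p hpS]⟩)
  refine h.trans_eq ?_
  rw [← mul_prod_erase _ _ (mem_range.2 hj), if_pos rfl,
    prod_congr rfl (g := fun _ => 5 * A * d + 1) (fun i hi => by rw [if_neg (ne_of_mem_erase hi)]),
    prod_const, card_erase_of_mem (mem_range.2 hj), card_range]

/-- With `A = ⌈k ^ (1 / d)⌉`, a long extent allows averaging over `A` intervals, and without one
every slab is thin enough by volume. -/
theorem exists_cut {d : ℕ} (hd : 0 < d) {x : ℕ → ℕ → ℝ} {S : Finset ℕ} (hS : Separated d x S)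
    {k : ℕ} (h2 : 2 ≤ S.card) (hk : S.card ≤ k) :
    ∃ j < d, ∃ p ∈ S, ∃ σ : ℝ, (σ = 0 ∨ σ = 3) ∧ (∃ u ∈ S, x u j < x p j + σ) ∧
      (∃ u ∈ S, x p j + σ ≤ x u j) ∧
      ((slab x S j (x p j + σ)).card : ℝ) ≤ cutConst d * (k : ℝ) ^ (1 - 1 / (d : ℝ)) := by
  have hk0 : 0 < k := by omega
  have hk1 : (1 : ℝ) ≤ k := by exact_mod_cast hk0
  have hd1 : (1 : ℝ) ≤ d := by exact_mod_cast hd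
  set L : ℝ := (k : ℝ) ^ (1 / (d : ℝ)) with hL
  set K : ℝ := (k : ℝ) ^ (1 - 1 / (d : ℝ)) with hK
  have hL1 : 1 ≤ L := Real.one_le_rpow hk1 (by positivity)
  have hK0 : 0 ≤ K := by positivity
  have hLK : L * K = k := rpow_dim_mul hk0
  have hLd : L ^ (d - 1) = K := rpow_dim_pow hd
  set A : ℕ := ⌈L⌉₊ with hA
  have hLA : L ≤ A := Nat.le_ceil L
  have hAL : (A : ℝ) ≤ 2 * L := by linarith [Nat.ceil_lt_add_one (show 0 ≤ L by linarith)]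
  have hA0 : 0 < A := Nat.ceil_pos.2 (by linarith)
  have hC1 : (1 : ℝ) ≤ cutConst d := by
    have : 0 < cutConst d := by unfold cutConst; positivity
    exact_mod_cast this
  obtain ⟨p, hp, q, hq, hpq⟩ := one_lt_card.1 (show 1 < S.card by omega)
  by_cases hshort : ∀ j < d, ∀ a ∈ S, ∀ b ∈ S, x b j - x a j < 5 * (A : ℝ)
  -- Every cut has few points near it here. Cutting through the larger of two different coordinates,
  -- with shift `0`, leaves a point on either side.
  · obtain ⟨j, hj, hlt⟩ := hS p hp q hq hpq
    have hne : x p j ≠ x q j := by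
      intro h
      rw [h, sub_self, abs_zero] at hlt
      exact absurd hlt (not_lt.2 (by positivity))
    have hcount : ∀ τ, ((slab x S j τ).card : ℝ) ≤ cutConst d * K := by
      intro τ
      have h := slab_card_le_of_short hd hS hshort hj τ
      have h' : ((slab x S j τ).card : ℝ) ≤ (4 * d + 1) * (5 * A * d + 1) ^ (d - 1) := by
        exact_mod_cast h
      refine h'.trans ?_
      -- This is the source of the `11` in `cutConst`: `A ≤ 2 * L` and `1 ≤ d * L`.
      have h3 : (5 * A * d + 1 : ℝ) ≤ 11 * d * L := by nlinarith
      calc ((4 * d + 1) * (5 * A * d + 1) ^ (d - 1) : ℝ)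
          ≤ (4 * d + 1) * (11 * d * L) ^ (d - 1) := by gcongr
        _ = cutConst d * K := by rw [mul_pow, hLd, cutConst]; push_cast; ring
    rcases lt_or_gt_of_ne hne with h | h
    · exact ⟨j, hj, q, hq, 0, .inl rfl, ⟨p, hp, by linarith⟩, ⟨q, hq, by linarith⟩, hcount _⟩
    · exact ⟨j, hj, p, hp, 0, .inl rfl, ⟨q, hq, by linarith⟩, ⟨p, hp, by linarith⟩, hcount _⟩
  · push Not at hshort
    obtain ⟨j, hj, a, ha, b, hb, hab⟩ := hshort
    have hcard : (S.card : ℝ) ≤ A * K := by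
      calc (S.card : ℝ) ≤ k := by exact_mod_cast hk
        _ = L * K := hLK.symm
        _ ≤ A * K := by gcongr
    obtain ⟨p, hp, h1, h2, h3⟩ := exists_cut_of_long hA0 hcard ha hb hab
    exact ⟨j, hj, p, hp, 3, .inr rfl, h1, h2, h3.trans (by nlinarith)⟩

end Packing

/-! ### Derivations of packings

A fact is a number, read through the tables `head` and `tail` as a list: a count `m`, then for every
coordinate two pairs (point, shift) that give the sides of a half-open box, then a list of points.
It is valid if there is a packing of `m` points in the box such that the list contains all its
points near the boundary of the box. -/

namespace Packing

open Finset RealRAM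

/-- Derivations see numbers only through these functions. Soundness needs nothing about the encoding
except `head 0 = 0`, so numbers that encode nothing sensible do no harm. -/
structure Tables where
  head : ℕ → ℕ
  tail : ℕ → ℕ
  coord : ℕ → ℕ → ℝ
  shift : ℕ → ℝ

namespace Tables

variable (T : Tables)

def digit (i f : ℕ) : ℕ := T.head (T.tail^[i] f)

def lo (f j : ℕ) : ℝ := T.coord j (T.digit (4 * j + 1) f) + T.shift (T.digit (4 * j + 2) f)

def hi (f j : ℕ) : ℝ := T.coord j (T.digit (4 * j + 3) f) + T.shift (T.digit (4 * j + 4) f)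

/-- The list of points of a fact. -/
def points (d f : ℕ) : ℕ := T.tail^[4 * d + 1] f

/-- The head of a list of points. -/
def point (g j : ℕ) : ℝ := T.coord j (T.head g - 1)

/-- The distance `2` is the range of a conflict in each coordinate, see `Conflict.close`. -/
def Near (d : ℕ) (y : ℕ → ℝ) (f : ℕ) : Prop :=
  ∃ j < d, y j < T.lo f j + 2 ∨ T.hi f j - 2 ≤ y j

/-- Facts about a single point. -/
def Base (d n f : ℕ) : Prop :=
  T.digit 0 f = 1 ∧ 1 ≤ T.head (T.points d f) ∧ T.head (T.points d f) ≤ n ∧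
    ∀ j < d, T.lo f j ≤ T.point (T.points d f) j ∧ T.point (T.points d f) j < T.hi f j

/-- The box of `f₃` contains those of `f₁` and `f₂`, which are on two sides of a hyperplane. -/
def Splits (d f₁ f₂ f₃ : ℕ) : Prop :=
  T.digit 0 f₃ = T.digit 0 f₁ + T.digit 0 f₂ ∧ (∃ j < d, T.hi f₁ j ≤ T.lo f₂ j) ∧
    ∀ j < d, T.lo f₃ j ≤ T.lo f₁ j ∧ T.lo f₃ j ≤ T.lo f₂ j ∧ T.hi f₁ j ≤ T.hi f₃ j ∧
      T.hi f₂ j ≤ T.hi f₃ j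

/-- Points near faces of the smaller box only may be forgotten; they matter for the cut just undone,
but for no later join. -/
def Keeps (d f f₃ : ℕ) : Prop :=
  ∀ g, Chain T.tail (T.points d f) g → T.Near d (T.point g) f₃ →
    ∃ g', Chain T.tail (T.points d f₃) g' ∧ T.head g' = T.head g

/-- Packings for `f₁` and `f₂` can be joined to one for `f₃`. -/
def Joins (d : ℕ) (Cf : (ℕ → ℝ) → (ℕ → ℝ) → Prop) (f₁ f₂ f₃ : ℕ) : Prop :=
  T.Splits d f₁ f₂ f₃ ∧
  (∀ g₁, Chain T.tail (T.points d f₁) g₁ → ∀ g₂, Chain T.tail (T.points d f₂) g₂ →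
    ¬ Cf (T.point g₁) (T.point g₂)) ∧
  T.Keeps d f₁ f₃ ∧ T.Keeps d f₂ f₃

def Derives (d n V : ℕ) (Cf : (ℕ → ℝ) → (ℕ → ℝ) → Prop) (F : Set ℕ) (f : ℕ) : Prop :=
  T.Base d n f ∨ ∃ f₁, (1 ≤ f₁ ∧ f₁ ≤ V) ∧ ∃ f₂, (1 ≤ f₂ ∧ f₂ ≤ V) ∧
    f₁ ∈ F ∧ f₂ ∈ F ∧ T.Joins d Cf f₁ f₂ f

/-- The point `p` as a function of the coordinate. -/
def pt (p : ℕ) : ℕ → ℝ := fun j => T.coord j p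

def IsPacking (Cf : (ℕ → ℝ) → (ℕ → ℝ) → Prop) (P : Finset ℕ) : Prop :=
  ∀ p ∈ P, ∀ q ∈ P, p ≠ q → ¬ Cf (T.pt p) (T.pt q)

/-- The list may contain further points, even outside `P`: superfluous entries only add conditions
for a join. -/
def Valid (d n : ℕ) (Cf : (ℕ → ℝ) → (ℕ → ℝ) → Prop) (f : ℕ) : Prop :=
  ∃ P ⊆ range n, P.card = T.digit 0 f ∧ T.IsPacking Cf P ∧
    (∀ p ∈ P, ∀ j < d, T.lo f j ≤ T.coord j p ∧ T.coord j p < T.hi f j) ∧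
    ∀ p ∈ P, T.Near d (T.pt p) f → ∃ g, Chain T.tail (T.points d f) g ∧ T.head g = p + 1

variable {T} {d n V : ℕ} {Cf : (ℕ → ℝ) → (ℕ → ℝ) → Prop}

theorem IsPacking.mono {P P' : Finset ℕ} (h : T.IsPacking Cf P) (hP : P' ⊆ P) :
    T.IsPacking Cf P' :=
  fun p hp q hq => h p (hP hp) q (hP hq)

theorem Derives.mono {F G : Set ℕ} (h : F ⊆ G) {f : ℕ} (hf : T.Derives d n V Cf F f) :
    T.Derives d n V Cf G f := by
  rcases hf with hb | ⟨f₁, h1, f₂, h2, m1, m2, hj⟩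
  · exact .inl hb
  · exact .inr ⟨f₁, h1, f₂, h2, h m1, h m2, hj⟩

theorem point_of_head {g p : ℕ} (h : T.head g = p + 1) : T.point g = T.pt p := by
  funext j
  simp [point, pt, h]

theorem valid_of_base (hhead : T.head 0 = 0) {f : ℕ}
    (h : T.Base d n f) : T.Valid d n Cf f := by
  obtain ⟨h0, h1, h2, h3⟩ := h
  obtain ⟨p, hp⟩ : ∃ p, T.head (T.points d f) = p + 1 := ⟨_, (Nat.sub_add_cancel h1).symm⟩
  have hne : T.points d f ≠ 0 := by
    intro h
    rw [h, hhead] at hp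
    omega
  refine ⟨{p}, by simp; omega, by simp [h0], ?_, ?_, ?_⟩
  · intro a ha b hb hab
    rw [mem_singleton] at ha hb
    exact absurd (ha.trans hb.symm) hab
  · intro a ha j hj
    rw [mem_singleton] at ha
    subst ha
    have := h3 j hj
    rwa [point_of_head hp] at this
  · intro a ha _
    rw [mem_singleton] at ha
    subst ha
    exact ⟨_, .here hne, hp⟩

theorem Near.of_le {y : ℕ → ℝ} {f f' : ℕ} (h : T.Near d y f')
    (hlo : ∀ j < d, T.lo f' j ≤ T.lo f j) (hhi : ∀ j < d, T.hi f j ≤ T.hi f' j) :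
    T.Near d y f := by
  obtain ⟨j, hj, h | h⟩ := h
  · exact ⟨j, hj, .inl (by linarith [hlo j hj])⟩
  · exact ⟨j, hj, .inr (by linarith [hhi j hj])⟩

/-- A conflict across the cut would involve points at most `2` apart in coordinate `j`, hence both
near the cut. Both are then in the lists, which have been checked for conflicts. A point near a face
of the large box is near a face of its own smaller box, so it was listed there and has been kept. -/
theorem valid_of_joins (hsymm : ∀ y z, Cf y z → Cf z y)
    (hclose : ∀ y z, Cf y z → ∀ j < d, |y j - z j| ≤ 2) {f₁ f₂ f₃ : ℕ}
    (h₁ : T.Valid d n Cf f₁) (h₂ : T.Valid d n Cf f₂) (h : T.Joins d Cf f₁ f₂ f₃) :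
    T.Valid d n Cf f₃ := by
  classical
  obtain ⟨⟨hm, ⟨j, hj, hcut⟩, hbox⟩, hcf, hk1, hk2⟩ := h
  obtain ⟨P₁, hP₁, hc₁, hp₁, hb₁, hn₁⟩ := h₁
  obtain ⟨P₂, hP₂, hc₂, hp₂, hb₂, hn₂⟩ := h₂
  have hlt : ∀ p ∈ P₁, ∀ q ∈ P₂, T.coord j p < T.coord j q := fun p hp q hq => by
    linarith [(hb₁ p hp j hj).2, (hb₂ q hq j hj).1]
  have hdisj : Disjoint P₁ P₂ := by
    rw [Finset.disjoint_left]
    exact fun p hp hp' => lt_irrefl _ (hlt p hp p hp')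
  have hcross : ∀ p ∈ P₁, ∀ q ∈ P₂, ¬ Cf (T.pt p) (T.pt q) := by
    intro p hp q hq hcon
    have h2 := abs_le.1 (hclose _ _ hcon j hj)
    simp only [pt] at h2
    obtain ⟨g₁, hg₁, he₁⟩ := hn₁ p hp ⟨j, hj, .inr (by
      simp only [pt]; linarith [(hb₂ q hq j hj).1])⟩
    obtain ⟨g₂, hg₂, he₂⟩ := hn₂ q hq ⟨j, hj, .inl (by
      simp only [pt]; linarith [(hb₁ p hp j hj).2])⟩
    have := hcf g₁ hg₁ g₂ hg₂
    rw [point_of_head he₁, point_of_head he₂] at this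
    exact this hcon
  refine ⟨P₁ ∪ P₂, union_subset hP₁ hP₂, ?_, ?_, ?_, ?_⟩
  · rw [card_union_of_disjoint hdisj, hc₁, hc₂, hm]
  · intro p hp q hq hpq
    rcases mem_union.1 hp with hp | hp <;> rcases mem_union.1 hq with hq | hq
    · exact hp₁ p hp q hq hpq
    · exact hcross p hp q hq
    · exact fun hcon => hcross q hq p hp (hsymm _ _ hcon)
    · exact hp₂ p hp q hq hpq
  · intro p hp i hi
    obtain ⟨b1, b2, b3, b4⟩ := hbox i hi
    rcases mem_union.1 hp with hp | hp
    · exact ⟨b1.trans (hb₁ p hp i hi).1, (hb₁ p hp i hi).2.trans_le b3⟩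
    · exact ⟨b2.trans (hb₂ p hp i hi).1, (hb₂ p hp i hi).2.trans_le b4⟩
  · intro p hp hnear
    rcases mem_union.1 hp with hp | hp
    · obtain ⟨g, hg, he⟩ := hn₁ p hp
        (hnear.of_le (fun i hi => (hbox i hi).1) (fun i hi => (hbox i hi).2.2.1))
      obtain ⟨g', hg', he'⟩ := hk1 g hg (by rwa [point_of_head he])
      exact ⟨g', hg', he'.trans he⟩
    · obtain ⟨g, hg, he⟩ := hn₂ p hp
        (hnear.of_le (fun i hi => (hbox i hi).2.1) (fun i hi => (hbox i hi).2.2.2))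
      obtain ⟨g', hg', he'⟩ := hk2 g hg (by rwa [point_of_head he])
      exact ⟨g', hg', he'.trans he⟩

theorem valid_of_derives (hhead : T.head 0 = 0) (hsymm : ∀ y z, Cf y z → Cf z y)
    (hclose : ∀ y z, Cf y z → ∀ j < d, |y j - z j| ≤ 2) {F : Set ℕ}
    (hF : ∀ f ∈ F, T.Valid d n Cf f) {f : ℕ} (h : T.Derives d n V Cf F f) :
    T.Valid d n Cf f := by
  rcases h with hb | ⟨f₁, _, f₂, _, m1, m2, hj⟩
  · exact valid_of_base hhead hb
  · exact valid_of_joins hsymm hclose (hF _ m1) (hF _ m2) hj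

/-- The facts derivable in `i` rounds. -/
def derivable (T : Tables) (d n V : ℕ) (Cf : (ℕ → ℝ) → (ℕ → ℝ) → Prop) : ℕ → Set ℕ
  | 0 => ∅
  | i + 1 => {f | (1 ≤ f ∧ f ≤ V) ∧ T.Derives d n V Cf (derivable T d n V Cf i) f}

theorem derivable_subset_succ (i : ℕ) :
    T.derivable d n V Cf i ⊆ T.derivable d n V Cf (i + 1) := by
  induction i with
  | zero => exact Set.empty_subset _
  | succ i ih => exact fun f hf => ⟨hf.1, hf.2.mono ih⟩

theorem derivable_mono : Monotone (T.derivable d n V Cf) :=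
  monotone_nat_of_le_succ derivable_subset_succ

/-! ### Encoding -/

/-- The tables read numbers up to `V` as lists of digits in base `N`. -/
structure Encodes (T : Tables) (N V : ℕ) : Prop where
  base : 1 < N
  head : ∀ g < V, T.head g = g % N
  tail : ∀ g < V, T.tail g = g / N

theorem Encodes.iterate_tail {N : ℕ} (h : T.Encodes N V) (l : List ℕ) (hl : ∀ a ∈ l, a < N)
    (hV : Nat.ofDigits N l < V) (i : ℕ) :
    T.tail^[i] (Nat.ofDigits N l) = Nat.ofDigits N (l.drop i) ∧
      Nat.ofDigits N (l.drop i) < V := by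
  induction i with
  | zero => exact ⟨rfl, hV⟩
  | succ i ih =>
    rw [Function.iterate_succ_apply', ih.1, h.tail _ ih.2, ← List.tail_drop]
    have hdiv : Nat.ofDigits N (l.drop i) / N = Nat.ofDigits N (l.drop i).tail :=
      Nat.ofDigits_div_eq_ofDigits_tail (by linarith [h.base]) _
        (fun a ha => hl a (List.mem_of_mem_drop ha))
    exact ⟨hdiv, by rw [← hdiv]; exact (Nat.div_le_self _ _).trans_lt ih.2⟩

theorem Encodes.digit_ofDigits {N : ℕ} (h : T.Encodes N V) (l : List ℕ) (hl : ∀ a ∈ l, a < N)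
    (hV : Nat.ofDigits N l < V) (i : ℕ) : T.digit i (Nat.ofDigits N l) = l.getD i 0 := by
  obtain ⟨h1, h2⟩ := h.iterate_tail l hl hV i
  rw [digit, h1, h.head _ h2, List.getD_eq_getElem?_getD]
  cases hd : l.drop i with
  | nil =>
    rw [List.getElem?_eq_none (List.drop_eq_nil_iff.1 hd)]
    simp
  | cons a t =>
    have hget : l[i]? = some a := by
      rw [← List.head?_drop, hd]; rfl
    have ha : a < N := hl a (List.mem_of_getElem? hget)
    rw [hget, Nat.ofDigits_cons]
    simp [Nat.add_mod, Nat.mod_eq_of_lt ha]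

/-- Digits of points are nonzero, so the number of a nonempty list is nonzero and the chain ends
exactly where the list does. -/
theorem Encodes.chain_iff {N : ℕ} (h : T.Encodes N V) (l : List ℕ) (hl : ∀ a ∈ l, a < N)
    (hl0 : ∀ a ∈ l, a ≠ 0) (hV : Nat.ofDigits N l < V) (a : ℕ) :
    (∃ g, Chain T.tail (Nat.ofDigits N l) g ∧ T.head g = a) ↔ a ∈ l := by
  induction l with
  | nil => simp [Chain.not_zero]
  | cons b l ih =>
    have hb := hl b (by simp)
    have hne : Nat.ofDigits N (b :: l) ≠ 0 := by
      have := hl0 b (by simp)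
      rw [Nat.ofDigits_cons]
      simp [this]
    have h1 := h.iterate_tail _ hl hV 1
    have h0 := h.digit_ofDigits _ hl hV 0
    simp only [Function.iterate_one, List.drop_one, List.tail_cons] at h1
    simp only [digit, Function.iterate_zero, id, List.getD_cons_zero] at h0
    have ih := ih (fun a ha => hl a (by simp [ha])) (fun a ha => hl0 a (by simp [ha])) h1.2
    rw [List.mem_cons, ← ih]
    constructor
    · rintro ⟨g, hg, rfl⟩
      rcases (Chain.iff_of_ne_zero hne).1 hg with rfl | hg
      · exact .inl h0
      · rw [h1.1] at hg
        exact .inr ⟨g, hg, rfl⟩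
    · rintro (rfl | ⟨g, hg, rfl⟩)
      · exact ⟨_, .here hne, h0⟩
      · exact ⟨g, .next hne (by rwa [h1.1]), rfl⟩

/-- The fact with count `m`, sides `h 0, …, h (4 d - 1)` and list of points `F`. -/
def fact (N d m : ℕ) (h : ℕ → ℕ) (F : List ℕ) : ℕ :=
  Nat.ofDigits N (m :: ((List.range (4 * d)).map h ++ F))

/-- These bounds put the number of the fact below `N ^ (4 * d + 1 + M)`; the positive count makes it
at least `1`, within the range of the sweep. -/
structure IsFact (N d M m : ℕ) (h : ℕ → ℕ) (F : List ℕ) : Prop where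
  count_pos : 0 < m
  count : m < N
  side : ∀ i, h i < N
  lt : ∀ a ∈ F, a < N
  ne : ∀ a ∈ F, a ≠ 0
  length : F.length ≤ M

theorem IsFact.digits_lt {N M m : ℕ} {h : ℕ → ℕ} {F : List ℕ} (H : IsFact N d M m h F) :
    ∀ a ∈ m :: ((List.range (4 * d)).map h ++ F), a < N := by
  intro a ha
  simp only [List.mem_cons, List.mem_append, List.mem_map] at ha
  rcases ha with rfl | ⟨i, _, rfl⟩ | ha
  · exact H.count
  · exact H.side i
  · exact H.lt a ha

section fact

variable {N M m : ℕ} {h : ℕ → ℕ} {F : List ℕ}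

theorem IsFact.fact_lt (H : IsFact N d M m h F) (hN : 1 < N) :
    fact N d m h F < N ^ (4 * d + 1 + M) := by
  refine (Nat.ofDigits_lt_base_pow_length hN H.digits_lt).trans_le ?_
  refine Nat.pow_le_pow_right (by omega) ?_
  have := H.length
  simp
  omega

theorem IsFact.fact_pos (H : IsFact N d M m h F) : 1 ≤ fact N d m h F := by
  have := H.count_pos
  rw [fact, Nat.ofDigits_cons]
  simp
  omega

theorem IsFact.digit_zero (H : IsFact N d M m h F)
    (hT : T.Encodes N (N ^ (4 * d + 1 + M))) : T.digit 0 (fact N d m h F) = m := by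
  rw [fact, hT.digit_ofDigits _ H.digits_lt (H.fact_lt hT.base)]
  simp

theorem IsFact.digit_succ (H : IsFact N d M m h F)
    (hT : T.Encodes N (N ^ (4 * d + 1 + M))) {i : ℕ} (hi : i < 4 * d) :
    T.digit (i + 1) (fact N d m h F) = h i := by
  rw [fact, hT.digit_ofDigits _ H.digits_lt (H.fact_lt hT.base)]
  rw [List.getD_cons_succ, List.getD_append _ _ _ _ (by simpa using hi)]
  simp [List.getD_eq_getElem?_getD, hi]

theorem IsFact.lo_eq (H : IsFact N d M m h F)
    (hT : T.Encodes N (N ^ (4 * d + 1 + M))) {j : ℕ} (hj : j < d) :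
    T.lo (fact N d m h F) j = T.coord j (h (4 * j)) + T.shift (h (4 * j + 1)) := by
  rw [lo, H.digit_succ hT (by omega), H.digit_succ hT (by omega)]

theorem IsFact.hi_eq (H : IsFact N d M m h F)
    (hT : T.Encodes N (N ^ (4 * d + 1 + M))) {j : ℕ} (hj : j < d) :
    T.hi (fact N d m h F) j = T.coord j (h (4 * j + 2)) + T.shift (h (4 * j + 3)) := by
  rw [hi, H.digit_succ hT (by omega), H.digit_succ hT (by omega)]

theorem IsFact.points_eq (H : IsFact N d M m h F)
    (hT : T.Encodes N (N ^ (4 * d + 1 + M))) : T.points d (fact N d m h F) = Nat.ofDigits N F ∧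
    Nat.ofDigits N F < N ^ (4 * d + 1 + M) := by
  have := hT.iterate_tail _ H.digits_lt (H.fact_lt hT.base) (4 * d + 1)
  simpa [points, fact] using this

theorem IsFact.chain_iff (H : IsFact N d M m h F)
    (hT : T.Encodes N (N ^ (4 * d + 1 + M))) (a : ℕ) :
    (∃ g, Chain T.tail (T.points d (fact N d m h F)) g ∧ T.head g = a) ↔ a ∈ F := by
  obtain ⟨h1, h2⟩ := H.points_eq hT
  rw [h1]
  exact hT.chain_iff F H.lt H.ne h2 a

theorem IsFact.mem_of_chain (H : IsFact N d M m h F)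
    (hT : T.Encodes N (N ^ (4 * d + 1 + M))) {g : ℕ}
    (hg : Chain T.tail (T.points d (fact N d m h F)) g) :
    T.head g ∈ F :=
  (H.chain_iff hT _).1 ⟨g, hg, rfl⟩

end fact

end Tables

end Packing

/-! ### Completeness: dissecting a packing yields a derivation -/

namespace Packing

open Finset RealRAM

namespace Tables

variable {T : Tables} {d n : ℕ} {Cf : (ℕ → ℝ) → (ℕ → ℝ) → Prop}

/-- What completeness of the derivations needs of the tables and the parameters. -/
structure Complete (T : Tables) (d n k M : ℕ) (Cf : (ℕ → ℝ) → (ℕ → ℝ) → Prop) : Prop where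
  encodes : T.Encodes (n + 3) ((n + 3) ^ (4 * d + 1 + M))
  shift_zero : T.shift 0 = 0
  shift_one : T.shift 1 = 3
  shift_two : T.shift 2 = -3
  dim_pos : 0 < d
  length_pos : 0 < M
  length : 2 * d * (cutConst d * (k : ℝ) ^ (1 - 1 / (d : ℝ))) ≤ M
  separated : ∀ y z, (∀ j < d, |y j - z j| ≤ 1 / (d : ℝ)) → Cf y z

/-- The lower side in coordinate `j` of the box given by `h`. -/
def low (T : Tables) (h : ℕ → ℕ) (j : ℕ) : ℝ := T.coord j (h (4 * j)) + T.shift (h (4 * j + 1))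

def upp (T : Tables) (h : ℕ → ℕ) (j : ℕ) : ℝ := T.coord j (h (4 * j + 2)) + T.shift (h (4 * j + 3))

/-- The box given by `h` contains `S`, and few points of `S` are near each face. -/
structure Fits (T : Tables) (d n : ℕ) (K : ℝ) (h : ℕ → ℕ) (S : Finset ℕ) : Prop where
  side : ∀ i, h i < n + 3
  mem : ∀ p ∈ S, ∀ j < d, T.low h j ≤ T.coord j p ∧ T.coord j p < T.upp h j
  low_card : ∀ j < d, ((S.filter fun p => T.coord j p < T.low h j + 2).card : ℝ) ≤ K
  upp_card : ∀ j < d, ((S.filter fun p => T.upp h j - 2 ≤ T.coord j p).card : ℝ) ≤ K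

open Classical in
noncomputable def nearSet (T : Tables) (d : ℕ) (h : ℕ → ℕ) (S : Finset ℕ) : Finset ℕ :=
  S.filter fun p => ∃ j < d, T.coord j p < T.low h j + 2 ∨ T.upp h j - 2 ≤ T.coord j p

/-- The box has `2 * d` faces, each with at most `K` points near it. -/
theorem Fits.card_nearSet_le {K : ℝ} {h : ℕ → ℕ} {S : Finset ℕ} (H : T.Fits d n K h S) :
    ((T.nearSet d h S).card : ℝ) ≤ 2 * d * K := by
  classical
  have hsub : T.nearSet d h S ⊆ (range d).biUnion fun j =>
      (S.filter fun p => T.coord j p < T.low h j + 2) ∪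
        (S.filter fun p => T.upp h j - 2 ≤ T.coord j p) := by
    intro p hp
    obtain ⟨hpS, j, hj, hor⟩ := mem_filter.1 hp
    simp only [mem_biUnion, mem_range, mem_union, mem_filter]
    exact ⟨j, hj, hor.imp (fun h => ⟨hpS, h⟩) (fun h => ⟨hpS, h⟩)⟩
  have h1 := (card_le_card hsub).trans card_biUnion_le
  have h2 : ((T.nearSet d h S).card : ℝ) ≤ ∑ j ∈ range d, (2 * K) := by
    refine (Nat.cast_le.2 h1).trans ?_
    push_cast
    refine sum_le_sum fun j hj => ?_
    have h3 := H.low_card j (mem_range.1 hj)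
    have h4 := H.upp_card j (mem_range.1 hj)
    have h5 := card_union_le (S.filter fun p => T.coord j p < T.low h j + 2)
      (S.filter fun p => T.upp h j - 2 ≤ T.coord j p)
    have h6 : (((S.filter fun p => T.coord j p < T.low h j + 2) ∪
      (S.filter fun p => T.upp h j - 2 ≤ T.coord j p)).card : ℝ) ≤
      (S.filter fun p => T.coord j p < T.low h j + 2).card +
      (S.filter fun p => T.upp h j - 2 ≤ T.coord j p).card := by exact_mod_cast h5
    linarith
  rw [sum_const, card_range, nsmul_eq_mul] at h2
  linarith

/-- The list of the points of a set, as digits. -/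
noncomputable def digitsOf (S : Finset ℕ) : List ℕ := S.toList.map (· + 1)

theorem mem_digitsOf {S : Finset ℕ} {p : ℕ} : p + 1 ∈ digitsOf S ↔ p ∈ S := by
  simp [digitsOf]

theorem exists_of_mem_digitsOf {S : Finset ℕ} {a : ℕ} (h : a ∈ digitsOf S) :
    ∃ p ∈ S, a = p + 1 := by
  simp only [digitsOf, List.mem_map, mem_toList] at h
  obtain ⟨p, hp, rfl⟩ := h
  exact ⟨p, hp, rfl⟩

/-- Points are written as `p + 1 ≤ n`, which keeps `0` free as the end of a list; base `n + 3` has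
room for these, for counts up to `n` and for the shift indices `0`, `1`, `2`. -/
theorem isFact_digitsOf {M m : ℕ} {h : ℕ → ℕ} {S : Finset ℕ} (hS : S ⊆ range n) (hm : 0 < m)
    (hmn : m ≤ n) (hside : ∀ i, h i < n + 3) (hM : S.card ≤ M) :
    IsFact (n + 3) d M m h (digitsOf S) where
  count_pos := hm
  count := by omega
  side := hside
  lt a ha := by
    obtain ⟨p, hp, rfl⟩ := exists_of_mem_digitsOf ha
    have := mem_range.1 (hS hp)
    omega
  ne a ha := by
    obtain ⟨p, hp, rfl⟩ := exists_of_mem_digitsOf ha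
    omega
  length := by simpa [digitsOf] using hM

theorem Complete.isPacking_separated {k M : ℕ} (C : T.Complete d n k M Cf) {S : Finset ℕ}
    (hS : T.IsPacking Cf S) : Separated d T.pt S := by
  intro p hp q hq hpq
  by_contra! hcon
  exact hS p hp q hq hpq (C.separated _ _ hcon)

/-- Only one face changes. Points of the lower part near the new face lie in the slab, and the old
faces can only lose points, so the bound `K` does not deteriorate along the recursion. -/
theorem Fits.lowerPart {K : ℝ} {h : ℕ → ℕ} {S : Finset ℕ} (H : T.Fits d n K h S) {j p σ : ℕ}
    (hp : p < n + 3) (hσ : σ < n + 3) {τ : ℝ} (hτ : T.coord j p + T.shift σ = τ)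
    (hslab : ((slab T.pt S j τ).card : ℝ) ≤ K) :
    let h' := Function.update (Function.update h (4 * j + 2) p) (4 * j + 3) σ
    (∀ i, T.low h' i = T.low h i) ∧ (∀ i, i ≠ j → T.upp h' i = T.upp h i) ∧ T.upp h' j = τ ∧
      T.Fits d n K h' (S.filter fun u => T.coord j u < τ) := by
  intro h'
  have e1 : ∀ i, T.low h' i = T.low h i := fun i => by
    simp only [low, h']
    rw [Function.update_of_ne (by omega), Function.update_of_ne (by omega),
      Function.update_of_ne (by omega), Function.update_of_ne (by omega)]
  have e2 : ∀ i, i ≠ j → T.upp h' i = T.upp h i := fun i hi => by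
    simp only [upp, h']
    rw [Function.update_of_ne (by omega), Function.update_of_ne (by omega),
      Function.update_of_ne (by omega), Function.update_of_ne (by omega)]
  have e3 : T.upp h' j = τ := by
    simp only [upp, h']
    rw [Function.update_of_ne (by omega), Function.update_self, Function.update_self, hτ]
  refine ⟨e1, e2, e3, ?_, ?_, ?_, ?_⟩
  · intro i
    simp only [h', Function.update_apply]
    split_ifs
    exacts [hσ, hp, H.side i]
  · intro u hu i hi
    obtain ⟨huS, hu'⟩ := mem_filter.1 hu
    rw [e1]
    refine ⟨(H.mem u huS i hi).1, ?_⟩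
    by_cases hij : i = j
    · subst hij; rwa [e3]
    · rw [e2 i hij]; exact (H.mem u huS i hi).2
  · intro i hi
    refine le_trans (Nat.cast_le.2 (card_le_card fun u hu => ?_)) (H.low_card i hi)
    simp only [mem_filter, e1] at hu ⊢
    exact ⟨hu.1.1, hu.2⟩
  · intro i hi
    by_cases hij : i = j
    · subst hij
      refine le_trans (Nat.cast_le.2 (card_le_card fun u hu => ?_)) hslab
      simp only [mem_filter, e3] at hu
      exact mem_filter.2 ⟨hu.1.1, hu.2, by simp only [pt]; linarith [hu.1.2]⟩
    · refine le_trans (Nat.cast_le.2 (card_le_card fun u hu => ?_)) (H.upp_card i hi)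
      simp only [mem_filter, e2 i hij] at hu ⊢
      exact ⟨hu.1.1, hu.2⟩

/-- The mirror image of `Fits.lowerPart`, with points on the hyperplane going to the upper part. -/
theorem Fits.upperPart {K : ℝ} {h : ℕ → ℕ} {S : Finset ℕ} (H : T.Fits d n K h S) {j p σ : ℕ}
    (hp : p < n + 3) (hσ : σ < n + 3) {τ : ℝ} (hτ : T.coord j p + T.shift σ = τ)
    (hslab : ((slab T.pt S j τ).card : ℝ) ≤ K) :
    let h' := Function.update (Function.update h (4 * j) p) (4 * j + 1) σ
    (∀ i, T.upp h' i = T.upp h i) ∧ (∀ i, i ≠ j → T.low h' i = T.low h i) ∧ T.low h' j = τ ∧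
      T.Fits d n K h' (S.filter fun u => ¬ T.coord j u < τ) := by
  intro h'
  have e1 : ∀ i, T.upp h' i = T.upp h i := fun i => by
    simp only [upp, h']
    rw [Function.update_of_ne (by omega), Function.update_of_ne (by omega),
      Function.update_of_ne (by omega), Function.update_of_ne (by omega)]
  have e2 : ∀ i, i ≠ j → T.low h' i = T.low h i := fun i hi => by
    simp only [low, h']
    rw [Function.update_of_ne (by omega), Function.update_of_ne (by omega),
      Function.update_of_ne (by omega), Function.update_of_ne (by omega)]
  have e3 : T.low h' j = τ := by
    simp only [low, h']
    rw [Function.update_of_ne (by omega), Function.update_self, Function.update_self, hτ]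
  refine ⟨e1, e2, e3, ?_, ?_, ?_, ?_⟩
  · intro i
    simp only [h', Function.update_apply]
    split_ifs
    exacts [hσ, hp, H.side i]
  · intro u hu i hi
    obtain ⟨huS, hu'⟩ := mem_filter.1 hu
    rw [e1]
    refine ⟨?_, (H.mem u huS i hi).2⟩
    by_cases hij : i = j
    · subst hij; rw [e3]; exact not_lt.1 hu'
    · rw [e2 i hij]; exact (H.mem u huS i hi).1
  · intro i hi
    by_cases hij : i = j
    · subst hij
      refine le_trans (Nat.cast_le.2 (card_le_card fun u hu => ?_)) hslab
      simp only [mem_filter, e3, not_lt] at hu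
      exact mem_filter.2 ⟨hu.1.1, by simp only [pt]; linarith [hu.1.2], hu.2⟩
    · refine le_trans (Nat.cast_le.2 (card_le_card fun u hu => ?_)) (H.low_card i hi)
      simp only [mem_filter, e2 i hij] at hu ⊢
      exact ⟨hu.1.1, hu.2⟩
  · intro i hi
    refine le_trans (Nat.cast_le.2 (card_le_card fun u hu => ?_)) (H.upp_card i hi)
    simp only [mem_filter, e1] at hu ⊢
    exact ⟨hu.1.1, hu.2⟩

/-- Every packing that fits into a box gives rise to a derivable fact. -/
theorem Complete.exists_fact {k M : ℕ} (C : T.Complete d n k M Cf) :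
    ∀ (s : ℕ) (S : Finset ℕ) (h : ℕ → ℕ), S.card = s → 1 ≤ s → s ≤ k → S ⊆ range n →
      T.IsPacking Cf S → T.Fits d n (cutConst d * (k : ℝ) ^ (1 - 1 / (d : ℝ))) h S →
      ∃ F ⊆ S, F.card ≤ M ∧ T.nearSet d h S ⊆ F ∧
        fact (n + 3) d s h (digitsOf F) ∈ T.derivable d n ((n + 3) ^ (4 * d + 1 + M)) Cf s := by
  classical
  set K : ℝ := cutConst d * (k : ℝ) ^ (1 - 1 / (d : ℝ)) with hK
  intro s
  induction s using Nat.strong_induction_on with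
  | _ s ih =>
  intro S h hcard hs1 hsk hSn hpack hfit
  have hsn : s ≤ n := by
    have := card_le_card hSn
    rw [card_range] at this
    omega
  have hN : 1 < n + 3 := by omega
  have hnear : T.nearSet d h S ⊆ S := filter_subset _ _
  by_cases hs : s = 1
  · obtain ⟨p, rfl⟩ := card_eq_one.1 (hcard.trans hs)
    -- The single point is listed even if it is not near a face, because `Base` reads it off the
    -- list.
    refine ⟨{p}, subset_rfl, by rw [card_singleton]; exact C.length_pos, hnear, ?_⟩
    have HF : IsFact (n + 3) d M s h (digitsOf {p}) :=
      isFact_digitsOf hSn hs1 hsn hfit.side (by rw [card_singleton]; exact C.length_pos)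
    have hpn : p < n := by simpa using hSn
    have hhead : T.head (T.points d (fact (n + 3) d s h (digitsOf {p}))) = p + 1 := by
      obtain ⟨h1, h2⟩ := HF.points_eq C.encodes
      rw [h1, C.encodes.head _ h2]
      simp only [digitsOf, toList_singleton, List.map_cons, List.map_nil, Nat.ofDigits_singleton]
      exact Nat.mod_eq_of_lt (by omega)
    obtain ⟨s', rfl⟩ : ∃ s', s = s' + 1 := ⟨0, hs⟩
    refine ⟨⟨HF.fact_pos, (HF.fact_lt hN).le⟩, .inl ⟨?_, ?_, ?_, ?_⟩⟩
    · rw [HF.digit_zero C.encodes, hs]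
    · rw [hhead]; omega
    · rw [hhead]; omega
    · intro j hj
      rw [HF.lo_eq C.encodes hj, HF.hi_eq C.encodes hj, point_of_head hhead]
      exact hfit.mem p (mem_singleton_self p) j hj
  · obtain ⟨j, hj, p, hp, σ, hσ, ⟨u, hu, hu'⟩, ⟨v, hv, hv'⟩, hslab⟩ :=
      exists_cut C.dim_pos (C.isPacking_separated hpack) (k := k) (by omega) (by omega)
    obtain ⟨σ', hσ', hσn⟩ : ∃ σ' : ℕ, T.shift σ' = σ ∧ σ' < n + 3 := by
      rcases hσ with rfl | rfl
      · exact ⟨0, C.shift_zero, by omega⟩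
      · exact ⟨1, C.shift_one, by omega⟩
    set τ : ℝ := T.pt p j + σ with hτ
    have hpn : p < n + 3 := by
      have := mem_range.1 (hSn hp)
      omega
    have hτ' : T.coord j p + T.shift σ' = τ := by rw [hσ', hτ]; rfl
    obtain ⟨l1, l2, l3, l4⟩ := hfit.lowerPart hpn hσn hτ' hslab
    obtain ⟨m1, m2, m3, m4⟩ := hfit.upperPart hpn hσn hτ' hslab
    set h₁ := Function.update (Function.update h (4 * j + 2) p) (4 * j + 3) σ'
    set h₂ := Function.update (Function.update h (4 * j) p) (4 * j + 1) σ'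
    set S₁ := S.filter fun u => T.coord j u < τ with hS₁
    set S₂ := S.filter fun u => ¬ T.coord j u < τ with hS₂
    have hsum : S₁.card + S₂.card = s := by
      rw [hS₁, hS₂, card_filter_add_card_filter_not, hcard]
    have hu1 : u ∈ S₁ := mem_filter.2 ⟨hu, hu'⟩
    have hv2 : v ∈ S₂ := mem_filter.2 ⟨hv, not_lt.2 hv'⟩
    have hc1 : 1 ≤ S₁.card := card_pos.2 ⟨u, hu1⟩
    have hc2 : 1 ≤ S₂.card := card_pos.2 ⟨v, hv2⟩
    have hsub1 : S₁ ⊆ S := filter_subset _ _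
    have hsub2 : S₂ ⊆ S := filter_subset _ _
    obtain ⟨F₁, hF₁, hM₁, hn₁, hd₁⟩ := ih S₁.card (by omega) S₁ h₁ rfl hc1 (by omega)
      (hsub1.trans hSn) (hpack.mono hsub1) l4
    obtain ⟨F₂, hF₂, hM₂, hn₂, hd₂⟩ := ih S₂.card (by omega) S₂ h₂ rfl hc2 (by omega)
      (hsub2.trans hSn) (hpack.mono hsub2) m4
    have hM : (T.nearSet d h S).card ≤ M := by
      have := hfit.card_nearSet_le.trans C.length
      exact_mod_cast this
    refine ⟨T.nearSet d h S, hnear, hM, subset_rfl, ?_⟩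
    have H : IsFact (n + 3) d M s h (digitsOf (T.nearSet d h S)) :=
      isFact_digitsOf (hnear.trans hSn) (by omega) hsn hfit.side hM
    have H₁ : IsFact (n + 3) d M S₁.card h₁ (digitsOf F₁) :=
      isFact_digitsOf (hF₁.trans (hsub1.trans hSn)) hc1 (by omega) l4.side hM₁
    have H₂ : IsFact (n + 3) d M S₂.card h₂ (digitsOf F₂) :=
      isFact_digitsOf (hF₂.trans (hsub2.trans hSn)) hc2 (by omega) m4.side hM₂
    obtain ⟨s', rfl⟩ : ∃ s', s = s' + 1 := ⟨s - 1, by omega⟩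
    -- The list of the whole is exactly its near set, so it receives every listed point of a part
    -- that is near a face of the large box.
    have keeps : ∀ {m' : ℕ} {h' : ℕ → ℕ} {F' : Finset ℕ},
        IsFact (n + 3) d M m' h' (digitsOf F') → F' ⊆ S →
        T.Keeps d (fact (n + 3) d m' h' (digitsOf F'))
          (fact (n + 3) d (s' + 1) h (digitsOf (T.nearSet d h S))) := by
      intro m' h' F' H' hF' g hg hnear
      obtain ⟨q, hq, hqg⟩ := exists_of_mem_digitsOf (H'.mem_of_chain C.encodes hg)
      rw [point_of_head hqg] at hnear
      rw [H.chain_iff C.encodes, hqg, mem_digitsOf]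
      obtain ⟨i, hi, hor⟩ := hnear
      rw [H.lo_eq C.encodes hi, H.hi_eq C.encodes hi] at hor
      exact mem_filter.2 ⟨hF' hq, i, hi, hor⟩
    -- Both parts are nonempty, so each has fewer than `s` points and its fact is available one
    -- round earlier.
    refine ⟨⟨H.fact_pos, (H.fact_lt hN).le⟩, .inr ⟨_, ⟨H₁.fact_pos, (H₁.fact_lt hN).le⟩, _,
      ⟨H₂.fact_pos, (H₂.fact_lt hN).le⟩, derivable_mono (by omega) hd₁,
      derivable_mono (by omega) hd₂, ⟨?_, ⟨j, hj, ?_⟩, ?_⟩, ?_,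
      keeps H₁ (hF₁.trans hsub1), keeps H₂ (hF₂.trans hsub2)⟩⟩
    · rw [H.digit_zero C.encodes, H₁.digit_zero C.encodes, H₂.digit_zero C.encodes, hsum]
    · rw [H₁.hi_eq C.encodes hj, H₂.lo_eq C.encodes hj]
      exact (l3.trans m3.symm).le
    · intro i hi
      rw [H.lo_eq C.encodes hi, H₁.lo_eq C.encodes hi, H₂.lo_eq C.encodes hi,
        H.hi_eq C.encodes hi, H₁.hi_eq C.encodes hi, H₂.hi_eq C.encodes hi]
      change T.low h i ≤ T.low h₁ i ∧ T.low h i ≤ T.low h₂ i ∧ T.upp h₁ i ≤ T.upp h i ∧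
        T.upp h₂ i ≤ T.upp h i
      refine ⟨(l1 i).ge, ?_, ?_, (m1 i).le⟩
      -- The cut is not below the lower face, because `u` lies in the box and below the cut; dually,
      -- `v` keeps it from exceeding the upper face.
      · by_cases hij : i = j
        · subst hij
          rw [m3]
          exact (hfit.mem u hu i hi).1.trans hu'.le
        · exact (m2 i hij).ge
      · by_cases hij : i = j
        · subst hij
          rw [l3]
          exact hv'.trans (hfit.mem v hv i hi).2.le
        · exact (l2 i hij).le
    -- Listed points belong to the packing, and those of different lists lie on different sides of
    -- the cut, so they are distinct and free of conflict.
    · intro g₁ hg₁ g₂ hg₂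
      obtain ⟨q₁, hq₁, e₁⟩ := exists_of_mem_digitsOf (H₁.mem_of_chain C.encodes hg₁)
      obtain ⟨q₂, hq₂, e₂⟩ := exists_of_mem_digitsOf (H₂.mem_of_chain C.encodes hg₂)
      rw [point_of_head e₁, point_of_head e₂]
      refine hpack q₁ (hsub1 (hF₁ hq₁)) q₂ (hsub2 (hF₂ hq₂)) ?_
      rintro rfl
      exact (mem_filter.1 (hF₂ hq₂)).2 (mem_filter.1 (hF₁ hq₁)).2

/-- The dissection starts from the bounding box of `S` enlarged by `3` in every direction; since `3
> 2`, no point is near any of its faces. -/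
theorem Complete.exists_derivable {k M : ℕ} (C : T.Complete d n k M Cf) (hk : 1 ≤ k)
    {S : Finset ℕ} (hS : S ⊆ range n) (hpack : T.IsPacking Cf S) (hcard : S.card = k) :
    ∃ f ∈ T.derivable d n ((n + 3) ^ (4 * d + 1 + M)) Cf k, T.digit 0 f = k := by
  have hne : S.Nonempty := card_pos.1 (by omega)
  choose a ha hmin using fun j => exists_min_image S (fun u => T.coord j u) hne
  choose b hb hmax using fun j => exists_max_image S (fun u => T.coord j u) hne
  have hlt : ∀ {p}, p ∈ S → p < n := fun hp => mem_range.1 (hS hp)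
  -- For each coordinate: the minimal point, shift index `2` for `-3`, the maximal point, shift
  -- index `1` for `3`.
  let h : ℕ → ℕ := fun i =>
    if i % 4 = 0 then a (i / 4) else if i % 4 = 1 then 2 else if i % 4 = 2 then b (i / 4) else 1
  have hlow : ∀ j, T.low h j = T.coord j (a j) - 3 := fun j => by
    have e1 : h (4 * j) = a j := by simp [h]
    have e2 : h (4 * j + 1) = 2 := by simp [h, Nat.add_mod]
    rw [low, e1, e2, C.shift_two]; ring
  have hupp : ∀ j, T.upp h j = T.coord j (b j) + 3 := fun j => by
    have e1 : h (4 * j + 2) = b j := by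
      have : (4 * j + 2) / 4 = j := by omega
      simp [h, Nat.add_mod, this]
    have e2 : h (4 * j + 3) = 1 := by simp [h, Nat.add_mod]
    rw [upp, e1, e2, C.shift_one]
  have hK : (0 : ℝ) ≤ cutConst d * (k : ℝ) ^ (1 - 1 / (d : ℝ)) := by positivity
  have hfit : T.Fits d n (cutConst d * (k : ℝ) ^ (1 - 1 / (d : ℝ))) h S := by
    refine ⟨fun i => ?_, fun p hp j _ => ?_, fun j _ => ?_, fun j _ => ?_⟩
    · have := hlt (ha (i / 4))
      have := hlt (hb (i / 4))
      simp only [h]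
      split_ifs <;> omega
    · rw [hlow, hupp]
      exact ⟨by linarith [hmin j p hp], by linarith [hmax j p hp]⟩
    · rw [filter_eq_empty_iff.2, card_empty, Nat.cast_zero]
      · exact hK
      · intro p hp
        rw [hlow]
        linarith [hmin j p hp]
    · rw [filter_eq_empty_iff.2, card_empty, Nat.cast_zero]
      · exact hK
      · intro p hp
        rw [hupp]
        linarith [hmax j p hp]
  obtain ⟨F, hF, hM, -, hder⟩ := C.exists_fact k S h hcard hk le_rfl hS hpack hfit
  have hkn : k ≤ n := by
    have := card_le_card hS
    rw [card_range] at this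
    omega
  exact ⟨_, hder, (isFact_digitsOf (hF.trans hS) hk hkn hfit.side hM).digit_zero C.encodes⟩

end Tables

end Packing

/-! ### The derivation step as a formula -/

namespace RealRAM

def NExpr.tails : ℕ → NExpr → NExpr
  | 0, e => e
  | i + 1, e => .load 3 (NExpr.tails i e)

theorem NExpr.tails_eval (s : Memory) (i : ℕ) (e : NExpr) :
    (NExpr.tails i e).eval s = (s.nat 3)^[i] (e.eval s) := by
  induction i with
  | zero => rfl
  | succ i ih => rw [Function.iterate_succ_apply', ← ih]; rfl

theorem NExpr.Below.tails {D : ℕ} {e : NExpr} (h : e.Below D) (hD : 3 < D) (i : ℕ) :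
    (NExpr.tails i e).Below D := by
  induction i with
  | zero => exact h
  | succ i ih => exact ⟨hD, by omega, ih⟩

/-- The conjunction of the tests `b j`, `j < m`. -/
def Test.forall (b : ℕ → Test) : ℕ → Test
  | 0 => .natEq (.lit 0) (.lit 0)
  | m + 1 => .and (Test.forall b m) (b m)

def Test.exists (b : ℕ → Test) (m : ℕ) : Test := .not (Test.forall (fun j => .not (b j)) m)

theorem Test.holds_forall {s : Memory} {b : ℕ → Test} {m : ℕ} :
    (Test.forall b m).Holds s ↔ ∀ j < m, (b j).Holds s := by
  induction m with
  | zero => simp [Test.forall, Test.Holds]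
  | succ m ih => simp only [Test.forall, Test.Holds, ih, Nat.forall_lt_succ_right]

theorem Test.holds_exists {s : Memory} {b : ℕ → Test} {m : ℕ} :
    (Test.exists b m).Holds s ↔ ∃ j < m, (b j).Holds s := by
  simp [Test.exists, Test.Holds, Test.holds_forall]

theorem Test.below_forall {D : ℕ} {b : ℕ → Test} (h : ∀ j, (b j).Below D) (m : ℕ) :
    (Test.forall b m).Below D := by
  induction m with
  | zero => exact ⟨trivial, trivial⟩
  | succ m ih => exact ⟨ih, h m⟩

theorem Test.below_exists {D : ℕ} {b : ℕ → Test} (h : ∀ j, (b j).Below D) (m : ℕ) :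
    (Test.exists b m).Below D :=
  Test.below_forall (b := fun j => .not (b j)) h m

/-- Existential quantification. -/
def Formula.ex (t : Bool) (e : NExpr) (φ : Formula) : Formula := .not (.all t e (.not φ))

theorem Formula.holds_ex {t : Bool} {e : NExpr} {φ : Formula} {D : ℕ} {s : Memory} :
    (Formula.ex t e φ).Holds D s ↔
      ∃ w, Chain (step t s) (e.eval s) w ∧ φ.Holds (D + 1) (s.setNat D 0 w) := by
  simp [Formula.ex, Formula.Holds]

end RealRAM

/-! ### The derivation rules as tests and formulas -/

namespace Packing

open RealRAM

/-- A conflict relation between points of dimension `d` that a machine can test. -/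
structure Conflict (d : ℕ) where
  rel : (ℕ → ℝ) → (ℕ → ℝ) → Prop
  test : NExpr → NExpr → Test
  holds : ∀ s e f, (test e f).Holds s ↔
    rel (fun j => s.real j (e.eval s)) (fun j => s.real j (f.eval s))
  below : ∀ D e f, e.Below D → f.Below D → (test e f).Below D
  symm : ∀ y z, rel y z → rel z y
  close : ∀ y z, rel y z → ∀ j < d, |y j - z j| ≤ 2
  separated : ∀ y z, (∀ j < d, |y j - z j| ≤ 1 / (d : ℝ)) → rel y z

/-- The tables kept in a memory. -/
def tablesOf (d : ℕ) (s : Memory) : Tables := ⟨s.nat 2, s.nat 3, s.real, s.real d⟩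

theorem tablesOf_setNat (d : ℕ) (s : Memory) {a : ℕ} (ha : 4 ≤ a) (i v : ℕ) :
    tablesOf d (s.setNat a i v) = tablesOf d s := by
  simp only [tablesOf, Memory.setNat_real]
  rw [Memory.setNat_nat_ne _ _ _ (by omega), Memory.setNat_nat_ne _ _ _ (by omega)]

def digitE (i : ℕ) (e : NExpr) : NExpr := .load 2 (.tails i e)

def loE (d : ℕ) (e : NExpr) (j : ℕ) : RExpr :=
  .add (.load j (digitE (4 * j + 1) e)) (.load d (digitE (4 * j + 2) e))

def hiE (d : ℕ) (e : NExpr) (j : ℕ) : RExpr :=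
  .add (.load j (digitE (4 * j + 3) e)) (.load d (digitE (4 * j + 4) e))

def pointsE (d : ℕ) (e : NExpr) : NExpr := .tails (4 * d + 1) e

/-- The index of the first point of a list. -/
def indexE (g : NExpr) : NExpr := .sub (.load 2 g) (.lit 1)

def pointE (g : NExpr) (j : ℕ) : RExpr := .load j (indexE g)

section eval

variable (d : ℕ) (s : Memory)

theorem digitE_eval (i : ℕ) (e : NExpr) :
    (digitE i e).eval s = (tablesOf d s).digit i (e.eval s) := by
  simp [digitE, NExpr.eval, NExpr.tails_eval, Tables.digit, tablesOf]

theorem loE_eval (e : NExpr) (j : ℕ) :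
    (loE d e j).eval s = (tablesOf d s).lo (e.eval s) j := by
  simp only [loE, RExpr.eval, digitE_eval d, Tables.lo]; rfl

theorem hiE_eval (e : NExpr) (j : ℕ) :
    (hiE d e j).eval s = (tablesOf d s).hi (e.eval s) j := by
  simp only [hiE, RExpr.eval, digitE_eval d, Tables.hi]; rfl

theorem pointsE_eval (e : NExpr) :
    (pointsE d e).eval s = (tablesOf d s).points d (e.eval s) := NExpr.tails_eval _ _ _

theorem pointE_eval (g : NExpr) (j : ℕ) :
    (pointE g j).eval s = (tablesOf d s).point (g.eval s) j := rfl

end eval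

/-- The dimension is fixed, so the quantifier over coordinates is unrolled in the program text; the
disjunction is expressed by negation and conjunction. -/
def nearTest (d : ℕ) (g f : NExpr) : Test :=
  .exists (fun j => .not (.and (.not (.realLT (pointE g j) (.add (loE d f j) (.lit 2))))
    (.not (.realLE (.sub (hiE d f j) (.lit 2)) (pointE g j))))) d

def baseTest (d : ℕ) (f : NExpr) : Test :=
  .and (.natEq (digitE 0 f) (.lit 1)) <| .and (.natLE (.lit 1) (.load 2 (pointsE d f))) <|
    .and (.natLE (.load 2 (pointsE d f)) (.load 0 (.lit 0))) <|
      .forall (fun j => .and (.realLE (loE d f j) (pointE (pointsE d f) j))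
        (.realLT (pointE (pointsE d f) j) (hiE d f j))) d

def splitsTest (d : ℕ) (f₁ f₂ f₃ : NExpr) : Test :=
  .and (.natEq (digitE 0 f₃) (.add (digitE 0 f₁) (digitE 0 f₂))) <|
    .and (.exists (fun j => .realLE (hiE d f₁ j) (loE d f₂ j)) d) <|
      .forall (fun j => .and (.realLE (loE d f₃ j) (loE d f₁ j)) <|
        .and (.realLE (loE d f₃ j) (loE d f₂ j)) <|
          .and (.realLE (hiE d f₁ j) (hiE d f₃ j)) (.realLE (hiE d f₂ j) (hiE d f₃ j))) d

theorem holds_nearTest (d : ℕ) (s : Memory) (g f : NExpr) : (nearTest d g f).Holds s ↔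
    (tablesOf d s).Near d ((tablesOf d s).point (g.eval s)) (f.eval s) := by
  simp only [nearTest, Test.holds_exists, Test.Holds, RExpr.eval, loE_eval, hiE_eval,
    pointE_eval d, Tables.Near, not_and_or, not_not]
  norm_num

theorem holds_baseTest (d : ℕ) (s : Memory) (f : NExpr) : (baseTest d f).Holds s ↔
    (tablesOf d s).Base d (s.nat 0 0) (f.eval s) := by
  simp only [baseTest, Test.holds_forall, Test.Holds, NExpr.eval, loE_eval, hiE_eval,
    pointE_eval d, Tables.Base, digitE_eval d, pointsE_eval]
  rfl

theorem holds_splitsTest (d : ℕ) (s : Memory) (f₁ f₂ f₃ : NExpr) :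
    (splitsTest d f₁ f₂ f₃).Holds s ↔
      (tablesOf d s).Splits d (f₁.eval s) (f₂.eval s) (f₃.eval s) := by
  simp only [splitsTest, Test.holds_forall, Test.holds_exists, Test.Holds, NExpr.eval, loE_eval,
    hiE_eval, Tables.Splits, digitE_eval d]

section below

variable {D : ℕ} {d : ℕ}

theorem below_digitE (hD : 3 < D) {e : NExpr} (he : e.Below D) (i : ℕ) : (digitE i e).Below D :=
  ⟨by omega, by omega, he.tails hD i⟩

theorem below_loE (hD : 3 < D) {e : NExpr} (he : e.Below D) (j : ℕ) : (loE d e j).Below D :=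
  ⟨below_digitE hD he _, below_digitE hD he _⟩

theorem below_hiE (hD : 3 < D) {e : NExpr} (he : e.Below D) (j : ℕ) : (hiE d e j).Below D :=
  ⟨below_digitE hD he _, below_digitE hD he _⟩

theorem below_indexE (hD : 3 < D) {g : NExpr} (hg : g.Below D) : (indexE g).Below D :=
  ⟨⟨by omega, by omega, hg⟩, trivial⟩

theorem below_nearTest (hD : 3 < D) {g f : NExpr} (hg : g.Below D) (hf : f.Below D) :
    (nearTest d g f).Below D := by
  refine Test.below_exists (fun j => ?_) d
  exact ⟨⟨below_indexE hD hg, below_loE hD hf j, trivial⟩,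
    ⟨below_hiE hD hf j, trivial⟩, below_indexE hD hg⟩

theorem below_baseTest (hD : 3 < D) {f : NExpr} (hf : f.Below D) : (baseTest d f).Below D := by
  have hp : (pointsE d f).Below D := hf.tails hD _
  have hh : (NExpr.load 2 (pointsE d f)).Below D := ⟨by omega, by omega, hp⟩
  refine ⟨⟨below_digitE hD hf 0, trivial⟩, ⟨trivial, hh⟩, ⟨hh, by omega, by omega, trivial⟩,
    Test.below_forall (fun j => ?_) d⟩
  exact ⟨⟨below_loE hD hf j, below_indexE hD hp⟩, below_indexE hD hp, below_hiE hD hf j⟩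

theorem below_splitsTest (hD : 3 < D) {f₁ f₂ f₃ : NExpr} (h₁ : f₁.Below D) (h₂ : f₂.Below D)
    (h₃ : f₃.Below D) : (splitsTest d f₁ f₂ f₃).Below D := by
  refine ⟨⟨below_digitE hD h₃ 0, below_digitE hD h₁ 0, below_digitE hD h₂ 0⟩,
    Test.below_exists (fun j => ?_) d, Test.below_forall (fun j => ?_) d⟩
  · exact ⟨below_hiE hD h₁ j, below_loE hD h₂ j⟩
  · exact ⟨⟨below_loE hD h₃ j, below_loE hD h₁ j⟩, ⟨below_loE hD h₃ j, below_loE hD h₂ j⟩,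
      ⟨below_hiE hD h₁ j, below_hiE hD h₃ j⟩, below_hiE hD h₂ j, below_hiE hD h₃ j⟩

end below

/-- Variables: `5` holds the bound `V`, `7` the fact to be derived; array `4` marks facts. -/
def keepsFormula (d a : ℕ) : Formula :=
  .all true (pointsE d (.var a)) <| .not <| .and (.test (nearTest d (.var 10) (.var 7))) <|
    .not <| .ex true (pointsE d (.var 7)) <|
      .test (.natEq (.load 2 (.var 11)) (.load 2 (.var 10)))

/-- `Splits` is missing here: it needs no quantifier over lists and is tested in `derivesFormula`
together with the marks. -/
def joinsFormula {d : ℕ} (R : Conflict d) : Formula :=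
  .and (.all true (pointsE d (.var 8)) <| .all true (pointsE d (.var 9)) <|
      .test (.not (R.test (indexE (.var 10)) (indexE (.var 11))))) <|
    .and (keepsFormula d 8) (keepsFormula d 9)

/-- Variables `8` and `9` run through candidates for the two premises, `10` and `11` through lists
of points. The outer negations express a disjunction. -/
def derivesFormula {d : ℕ} (R : Conflict d) : Formula :=
  .not <| .and (.not (.test (baseTest d (.var 7)))) <| .not <|
    .ex false (.var 5) <| .ex false (.var 5) <| .and
      (.test (.and (.natEq (.load 4 (.var 8)) (.lit 1)) <|
        .and (.natEq (.load 4 (.var 9)) (.lit 1)) (splitsTest d (.var 8) (.var 9) (.var 7))))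
      (joinsFormula R)

/-- Some marked fact has count `k`. -/
def answerFormula : Formula :=
  .ex false (.var 5) <| .test <|
    .and (.natEq (.load 4 (.var 8)) (.lit 1)) (.natEq (digitE 0 (.var 8)) (.load 0 (.lit 1)))

theorem step_true (d : ℕ) (s : Memory) : Formula.step true s = (tablesOf d s).tail := by
  funext v; simp [Formula.step, tablesOf]

theorem step_false (s : Memory) : Formula.step false s = fun i => i - 1 := by
  funext v; simp [Formula.step]

def marks (s : Memory) : Set ℕ := {f | s.nat 4 f = 1}

theorem holds_keepsFormula (d : ℕ) (s : Memory) {a : ℕ} (ha : a < 10) :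
    (keepsFormula d a).Holds 10 s ↔ (tablesOf d s).Keeps d (s.nat a 0) (s.nat 7 0) := by
  have h10 : a ≠ 10 := by omega
  simp [keepsFormula, Formula.Holds, Formula.holds_ex, step_true d, pointsE_eval, holds_nearTest,
    tablesOf_setNat, NExpr.eval, Memory.setNat_nat, Tables.Keeps, Test.Holds]
  rfl

theorem holds_joinsFormula {d : ℕ} (R : Conflict d) (s : Memory) :
    ((tablesOf d s).Splits d (s.nat 8 0) (s.nat 9 0) (s.nat 7 0) ∧ (joinsFormula R).Holds 10 s) ↔
      (tablesOf d s).Joins d R.rel (s.nat 8 0) (s.nat 9 0) (s.nat 7 0) := by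
  simp [joinsFormula, Formula.Holds, holds_keepsFormula, Tables.Joins, step_true d, pointsE_eval,
    tablesOf_setNat, NExpr.eval, Memory.setNat_nat, R.holds, indexE, Test.Holds]
  intro _ _ _
  rfl

theorem holds_derivesFormula {d : ℕ} (R : Conflict d) (s : Memory) :
    (derivesFormula R).Holds 8 s ↔
      (tablesOf d s).Derives d (s.nat 0 0) (s.nat 5 0) R.rel (marks s) (s.nat 7 0) := by
  have key : ∀ f₁ f₂, ((tablesOf d s).Splits d f₁ f₂ (s.nat 7 0) ∧
      (joinsFormula R).Holds 10 ((s.setNat 8 0 f₁).setNat 9 0 f₂)) ↔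
      (tablesOf d s).Joins d R.rel f₁ f₂ (s.nat 7 0) := by
    intro f₁ f₂
    have := holds_joinsFormula R ((s.setNat 8 0 f₁).setNat 9 0 f₂)
    simpa [tablesOf_setNat, Memory.setNat_nat] using this
  simp only [derivesFormula, Formula.Holds, Formula.holds_ex, step_false, Chain.pred_iff,
    holds_baseTest, Test.Holds, holds_splitsTest, tablesOf_setNat d _ (show 4 ≤ 8 by norm_num),
    tablesOf_setNat d _ (show 4 ≤ 9 by norm_num), NExpr.eval, Memory.setNat_nat, and_assoc,
    Tables.Derives, marks, Set.mem_ofPred_eq, ← key]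
  simp [or_iff_not_imp_left]

theorem holds_answerFormula (d : ℕ) (s : Memory) : answerFormula.Holds 8 s ↔
    ∃ f, (1 ≤ f ∧ f ≤ s.nat 5 0) ∧ f ∈ marks s ∧ (tablesOf d s).digit 0 f = s.nat 0 1 := by
  simp [answerFormula, Formula.Holds, Formula.holds_ex, step_false, Chain.pred_iff, Test.Holds,
    digitE_eval d, tablesOf_setNat, NExpr.eval, Memory.setNat_nat, marks]

/-! ### Scopes of variables and bounds on quantifiers -/

theorem below_keepsFormula (d : ℕ) {a : ℕ} (ha : 1 < a) (ha' : a < 10) :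
    (keepsFormula d a).Below 10 := by
  have hv : ∀ {D a : ℕ}, 1 < a → a < D → (NExpr.var a).Below D :=
    fun h h' => ⟨h', by omega, trivial⟩
  refine ⟨(hv ha ha').tails (by omega) _,
    below_nearTest (by omega) (hv (by omega) (by omega)) (hv (by omega) (by omega)),
    (hv (by omega) (by omega)).tails (by omega) _, ?_⟩
  simp [Formula.Below, Test.Below, NExpr.Below]

theorem below_derivesFormula {d : ℕ} (R : Conflict d) : (derivesFormula R).Below 8 := by
  have hv : ∀ {D a : ℕ}, 1 < a → a < D → (NExpr.var a).Below D :=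
    fun h h' => ⟨h', by omega, trivial⟩
  refine ⟨below_baseTest (by omega) (hv (by omega) (by omega)), hv (by omega) (by omega),
    hv (by omega) (by omega), ⟨?_, ?_, below_splitsTest (by omega) (hv (by omega) (by omega))
      (hv (by omega) (by omega)) (hv (by omega) (by omega))⟩,
    ⟨(hv (by omega) (by omega)).tails (by omega) _, (hv (by omega) (by omega)).tails (by omega) _,
      R.below _ _ _ (below_indexE (by omega) (hv (by omega) (by omega)))
        (below_indexE (by omega) (hv (by omega) (by omega)))⟩,
    below_keepsFormula d (by omega) (by omega), below_keepsFormula d (by omega) (by omega)⟩ <;>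
  simp [Test.Below, NExpr.Below]

theorem below_answerFormula : answerFormula.Below 8 := by
  simp [answerFormula, Formula.ex, Formula.Below, Test.Below, NExpr.Below, digitE, NExpr.tails]

theorem iterate_le {g : ℕ → ℕ} (hg : ∀ v, g v ≤ v) (i v : ℕ) : g^[i] v ≤ v := by
  induction i with
  | zero => exact le_rfl
  | succ i ih => rw [Function.iterate_succ_apply']; exact (hg _).trans ih

/-- Tails never increase a number, so chains starting from a tail of a fact up to `V` also start at
most at `V`. -/
theorem bounded_derivesFormula {d : ℕ} (R : Conflict d) {s : Memory}
    (h3 : ∀ v, s.nat 3 v ≤ v) (h7 : s.nat 7 0 ≤ s.nat 5 0) :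
    (derivesFormula R).Bounded (s.nat 5 0) 8 s := by
  have hi : ∀ {v i : ℕ}, v ≤ s.nat 5 0 → (s.nat 3)^[i] v ≤ s.nat 5 0 :=
    fun h => (iterate_le h3 _ _).trans h
  simp only [derivesFormula, joinsFormula, keepsFormula, Formula.ex, Formula.Bounded, pointsE,
    NExpr.tails_eval, NExpr.eval, Memory.setNat_nat]
  simp +contextual [-Function.iterate_succ, Memory.setNat_nat_ne, hi, h7]

theorem bounded_answerFormula (s : Memory) : answerFormula.Bounded (s.nat 5 0) 8 s := by
  simp [answerFormula, Formula.ex, Formula.Bounded, NExpr.eval]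

end Packing

/-! ### Preparing the tables -/

namespace RealRAM

abbrev RExpr.var (r : ℕ) : RExpr := .load r (.lit 0)

def RExpr.pow (e : RExpr) : ℕ → RExpr
  | 0 => .lit 1
  | m + 1 => .mul (RExpr.pow e m) e

theorem RExpr.pow_eval (s : Memory) (e : RExpr) (m : ℕ) : (e.pow m).eval s = e.eval s ^ m := by
  induction m with
  | zero => simp [RExpr.pow, RExpr.eval]
  | succ m ih => simp [RExpr.pow, RExpr.eval, ih, pow_succ]

abbrev Program.setN (a : ℕ) (e : NExpr) : Program := .natStore a (.lit 0) e

abbrev Program.setR (r : ℕ) (e : RExpr) : Program := .realStore r (.lit 0) e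

/-- Adds the input number in cell `i` of array `0` to the real variable `r`. -/
def countProgram (i r : ℕ) : Program :=
  .seq (.setN 5 (.lit 0)) <| .loop (.not (.natEq (.var 5) (.load 0 (.lit i)))) <|
    .seq (.setR r (.add (.var r) (.lit 1))) (.setN 5 (.add (.var 5) (.lit 1)))

/-- The machine cannot cast natural numbers to reals, so a real counter is advanced in step with a
natural one. -/
theorem countProgram_runs (i r : ℕ) (s : Memory) :
    ∃ s' t, Runs (countProgram i r) s s' t ∧ t ≤ 19 * s.nat 0 i + 10 ∧
      (∀ a, a ≠ 5 → s'.nat a = s.nat a) ∧ (∀ a, a ≠ r → s'.real a = s.real a) ∧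
      s'.real r 0 = s.real r 0 + s.nat 0 i := by
  let I : ℕ → Memory → Prop := fun c s' => s'.nat 5 0 = c ∧
      (∀ a, a ≠ 5 → s'.nat a = s.nat a) ∧ (∀ a, a ≠ r → s'.real a = s.real a) ∧
      s'.real r 0 = s.real r 0 + c
  obtain ⟨s', t, hr, ht, hI⟩ := Runs.loop_count (m := s.nat 0 i) (T := 12)
    (b := .not (.natEq (.var 5) (.load 0 (.lit i))))
    (p := .seq (.setR r (.add (.var r) (.lit 1))) (.setN 5 (.add (.var 5) (.lit 1)))) I
    (s := s.setNat 5 0 0) (by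
      rintro c hc u ⟨h1, h2, h3, h4⟩
      refine ⟨?_, _, _, .seq (.realStore _ _ _ _) (.natStore _ _ _ _), ?_, ?_, ?_, ?_, ?_⟩
      · simp [Test.Holds, NExpr.eval, h1, h2]; omega
      · simp [RExpr.cost, NExpr.cost]
      · simp [Memory.setNat_nat, NExpr.eval, h1]
      · intro a ha
        rw [Memory.setNat_nat_ne _ _ _ ha, Memory.setReal_nat, h2 a ha]
      · intro a ha
        funext j
        simp [Memory.setReal_real, ha, h3 a ha]
      · simp [Memory.setReal_real, RExpr.eval, NExpr.eval, h4, add_assoc])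
    (by
      rintro u ⟨h1, h2, _⟩
      simp [Test.Holds, NExpr.eval, h1, h2])
    ⟨by simp [Memory.setNat_nat], fun a ha => Memory.setNat_nat_ne _ _ _ ha, fun a _ => rfl,
      by simp⟩
  refine ⟨s', _, .seq (.natStore _ _ _ _) hr, ?_, hI.2⟩
  simp only [Test.cost, NExpr.cost] at ht ⊢
  omega

end RealRAM

namespace Packing

open RealRAM

/-! Real variables: `d + 1` holds `k`, `d + 2` the base `N`, `d + 3` the length of lists of points,
`d + 4` the bound `V`, and `d + 5` the number of table entries filled. -/

def lengthTest (d C : ℕ) : Test :=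
  .realLT (RExpr.pow (.var (d + 3)) d)
    (.mul (.lit ((C : ℚ) ^ d)) (RExpr.pow (.var (d + 1)) (d - 1)))

def boundProgram (d C : ℕ) : Program :=
  .loop (lengthTest d C) <| .seq (.setR (d + 3) (.add (.var (d + 3)) (.lit 1)))
    (.setR (d + 4) (.mul (.var (d + 4)) (.var (d + 2))))

/-- The length of the lists of points in facts. -/
noncomputable def listLength (d C k : ℕ) : ℕ := ⌈C * (k : ℝ) ^ (1 - 1 / (d : ℝ))⌉₊

theorem rpow_dim_pow_self {d k : ℕ} (hd : 0 < d) :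
    ((k : ℝ) ^ (1 - 1 / (d : ℝ))) ^ d = (k : ℝ) ^ (d - 1) := by
  rw [← rpow_dim_pow hd, ← pow_mul, mul_comm, pow_mul]
  congr 1
  rw [← Real.rpow_natCast, ← Real.rpow_mul (by positivity), one_div,
    inv_mul_cancel₀ (by exact_mod_cast hd.ne'), Real.rpow_one]

/-- Raising to the power `d` turns `i < C * k ^ (1 - 1 / d)` into `i ^ d < C ^ d * k ^ (d - 1)`,
which needs no roots; for natural `i`, comparing with the ceiling is the same. -/
theorem holds_lengthTest {d C k i : ℕ} (hd : 0 < d) {s : Memory} (h3 : s.real (d + 3) 0 = i)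
    (h1 : s.real (d + 1) 0 = k) : (lengthTest d C).Holds s ↔ i < listLength d C k := by
  simp only [lengthTest, Test.Holds, RExpr.eval, RExpr.pow_eval, NExpr.eval, h3, h1]
  rw [listLength, Nat.lt_ceil, ← rpow_dim_pow_self hd]
  push_cast
  rw [← mul_pow]
  exact pow_lt_pow_iff_left₀ (by positivity) (by positivity) hd.ne'

/-- The bound is built up as a real number since naturals cannot be multiplied on the machine. One
factor is appended for each unit of list length. -/
theorem boundProgram_runs {d C k N : ℕ} (hd : 0 < d) {s : Memory} (h1 : s.real (d + 1) 0 = k)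
    (h2 : s.real (d + 2) 0 = N) (h3 : s.real (d + 3) 0 = 0) :
    ∃ s' t, Runs (boundProgram d C) s s' t ∧
      t ≤ listLength d C k * ((lengthTest d C).cost + 14) + ((lengthTest d C).cost + 1) ∧
      s'.nat = s.nat ∧ (∀ a, a ≠ d + 3 → a ≠ d + 4 → s'.real a = s.real a) ∧
      s'.real (d + 4) 0 = s.real (d + 4) 0 * N ^ listLength d C k := by
  let I : ℕ → Memory → Prop := fun i s' => s'.real (d + 3) 0 = i ∧ s'.nat = s.nat ∧
    (∀ a, a ≠ d + 3 → a ≠ d + 4 → s'.real a = s.real a) ∧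
    s'.real (d + 4) 0 = s.real (d + 4) 0 * N ^ i
  obtain ⟨s', t, hr, ht, hI⟩ := Runs.loop_count (m := listLength d C k) (T := 13)
    (b := lengthTest d C) (p := .seq (.setR (d + 3) (.add (.var (d + 3)) (.lit 1)))
      (.setR (d + 4) (.mul (.var (d + 4)) (.var (d + 2))))) I (s := s) (by
      rintro i hi u ⟨g1, g2, g3, g4⟩
      refine ⟨?_, _, _, .seq (.realStore _ _ _ _) (.realStore _ _ _ _), ?_, ?_, ?_, ?_, ?_⟩
      · rw [holds_lengthTest hd g1 (by rw [g3 _ (by omega) (by omega), h1])]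
        exact hi
      · simp [RExpr.cost, NExpr.cost]
      · simp [Memory.setReal_real, RExpr.eval, NExpr.eval, g1]
      · simp [g2]
      · intro a ha ha'
        funext j
        simp [Memory.setReal_real, ha, ha', g3 a ha ha']
      · simp [Memory.setReal_real, RExpr.eval, NExpr.eval, g4,
          g3 (d + 2) (by omega) (by omega), h2, pow_succ, mul_assoc])
    (by
      rintro u ⟨g1, g2, g3, g4⟩
      rw [holds_lengthTest hd g1 (by rw [g3 _ (by omega) (by omega), h1])]
      omega)
    ⟨by simp [h3], rfl, fun _ _ _ => rfl, by simp⟩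
  refine ⟨s', t, hr, ht.trans (le_of_eq (by ring)), hI.2⟩

/-- An odometer: `6` and `7` hold quotient and remainder of the entry number in `5`. Its real copy
`d + 5` is what gets compared with the bound, so at the end variable `5` holds `V` as a natural
number. -/
def tableBody (d : ℕ) : Program :=
  .seq (.natStore 2 (.var 5) (.var 7)) <| .seq (.natStore 3 (.var 5) (.var 6)) <|
    .seq (.setN 5 (.add (.var 5) (.lit 1))) <|
      .seq (.setR (d + 5) (.add (.var (d + 5)) (.lit 1))) <|
        .branch (.natEq (.add (.var 7) (.lit 1)) (.add (.load 0 (.lit 0)) (.lit 3)))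
          (.seq (.setN 7 (.lit 0)) (.setN 6 (.add (.var 6) (.lit 1))))
          (.setN 7 (.add (.var 7) (.lit 1)))

/-- Fills the tables of quotients and remainders modulo `n + 3`. -/
def tableProgram (d : ℕ) : Program :=
  .seq (.setN 5 (.lit 0)) <| .loop (.realLT (.var (d + 5)) (.var (d + 4))) (tableBody d)

/-- The first `i` entries of the tables have been filled. -/
structure TableInv (d n : ℕ) (s : Memory) (i : ℕ) (u : Memory) : Prop where
  index : u.nat 5 0 = i
  quotient : u.nat 6 0 = i / (n + 3)
  remainder : u.nat 7 0 = i % (n + 3)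
  counter : u.real (d + 5) 0 = i
  head : ∀ g, u.nat 2 g = if g < i then g % (n + 3) else 0
  tail : ∀ g, u.nat 3 g = if g < i then g / (n + 3) else 0
  nat : ∀ a, a ≠ 2 → a ≠ 3 → a ≠ 5 → a ≠ 6 → a ≠ 7 → u.nat a = s.nat a
  real : ∀ a, a ≠ d + 5 → u.real a = s.real a

theorem tableBody_runs {d n i : ℕ} {s u : Memory} (hn : s.nat 0 0 = n)
    (h : TableInv d n s i u) :
    ∃ u' t, Runs (tableBody d) u u' t ∧ t ≤ 41 ∧ TableInv d n s (i + 1) u' := by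
  have hi := Nat.div_add_mod i (n + 3)
  have hlt : i % (n + 3) < n + 3 := Nat.mod_lt _ (by omega)
  have h0 : u.nat 0 0 = n := by
    rw [h.nat 0 (by omega) (by omega) (by omega) (by omega) (by omega), hn]
  obtain ⟨h5, h6, h7, hc, h2, h3, hnat, hreal⟩ := h
  by_cases hcase : i % (n + 3) + 1 = n + 3
  · obtain ⟨e1, e2⟩ : (i + 1) / (n + 3) = i / (n + 3) + 1 ∧ (i + 1) % (n + 3) = 0 :=
      (Nat.div_mod_unique (by omega)).2 ⟨by rw [mul_add]; omega, by omega⟩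
    refine ⟨_, _, .seq (.natStore _ _ _ _) (.seq (.natStore _ _ _ _) (.seq (.natStore _ _ _ _)
      (.seq (.realStore _ _ _ _) (.branchTrue ?_ (.seq (.natStore _ _ _ _)
        (.natStore _ _ _ _)))))), ?_, ?_, ?_, ?_, ?_, ?_, ?_, ?_, ?_⟩
    · simp [Test.Holds, NExpr.eval, Memory.setNat_nat, h7, h0, hcase]
    · simp [Test.cost, NExpr.cost, RExpr.cost]
    · simp [Memory.setNat_nat, NExpr.eval, h5]
    · simp [Memory.setNat_nat, NExpr.eval, h6, e1]
    · simp [Memory.setNat_nat, NExpr.eval, e2]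
    · simp [Memory.setReal_real, NExpr.eval, RExpr.eval, hc]
    · intro g
      simp only [Memory.setNat_nat, Memory.setReal_nat, NExpr.eval, h5, h7, h2]
      by_cases hg : g = i
      · subst hg; simp
      · simp [hg, show g < i + 1 ↔ g < i by omega]
    · intro g
      simp only [Memory.setNat_nat, Memory.setReal_nat, NExpr.eval, h5, h6, h3]
      by_cases hg : g = i
      · subst hg; simp
      · simp [hg, show g < i + 1 ↔ g < i by omega]
    · intro a a2 a3 a5 a6 a7
      simp [Memory.setNat_nat_ne, a2, a3, a5, a6, a7,
        hnat a a2 a3 a5 a6 a7]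
    · intro a ha
      funext j
      simp [Memory.setReal_real, ha, hreal a ha]
  · obtain ⟨e1, e2⟩ : (i + 1) / (n + 3) = i / (n + 3) ∧ (i + 1) % (n + 3) = i % (n + 3) + 1 :=
      (Nat.div_mod_unique (by omega)).2 ⟨by omega, by omega⟩
    refine ⟨_, _, .seq (.natStore _ _ _ _) (.seq (.natStore _ _ _ _) (.seq (.natStore _ _ _ _)
      (.seq (.realStore _ _ _ _) (.branchFalse ?_ (.natStore _ _ _ _))))),
      ?_, ?_, ?_, ?_, ?_, ?_, ?_, ?_, ?_⟩
    · simpa [Test.Holds, NExpr.eval, Memory.setNat_nat, h7, h0] using by omega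
    · simp [Test.cost, NExpr.cost, RExpr.cost]
    · simp [Memory.setNat_nat, NExpr.eval, h5]
    · simp [Memory.setNat_nat, h6, e1]
    · simp [Memory.setNat_nat, NExpr.eval, h7, e2]
    · simp [Memory.setReal_real, NExpr.eval, RExpr.eval, hc]
    · intro g
      simp only [Memory.setNat_nat, Memory.setReal_nat, NExpr.eval, h5, h7, h2]
      by_cases hg : g = i
      · subst hg; simp
      · simp [hg, show g < i + 1 ↔ g < i by omega]
    · intro g
      simp only [Memory.setNat_nat, Memory.setReal_nat, NExpr.eval, h5, h6, h3]
      by_cases hg : g = i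
      · subst hg; simp
      · simp [hg, show g < i + 1 ↔ g < i by omega]
    · intro a a2 a3 a5 a6 a7
      simp [Memory.setNat_nat_ne, a2, a3, a5, a7,
        hnat a a2 a3 a5 a6 a7]
    · intro a ha
      funext j
      simp [Memory.setReal_real, ha, hreal a ha]

theorem tableProgram_runs {d n V : ℕ} {s : Memory} (hn : s.nat 0 0 = n)
    (hV : s.real (d + 4) 0 = V) (hf : s.real (d + 5) 0 = 0) (h2 : ∀ g, s.nat 2 g = 0)
    (h3 : ∀ g, s.nat 3 g = 0) (h6 : s.nat 6 0 = 0) (h7 : s.nat 7 0 = 0) :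
    ∃ s' t, Runs (tableProgram d) s s' t ∧ t ≤ 47 * V + 9 ∧ TableInv d n s V s' := by
  obtain ⟨s', t, hr, ht, hI⟩ := Runs.loop_count (m := V) (T := 41)
    (b := .realLT (.var (d + 5)) (.var (d + 4))) (p := tableBody d) (TableInv d n s)
    (s := s.setNat 5 0 0) (by
      intro i hi u hu
      refine ⟨?_, tableBody_runs hn hu⟩
      simp only [Test.Holds, RExpr.eval, NExpr.eval, hu.counter, hu.real (d + 4) (by omega), hV]
      exact_mod_cast hi)
    (by
      intro u hu
      simp [Test.Holds, RExpr.eval, NExpr.eval, hu.counter, hu.real (d + 4) (by omega), hV])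
    (by
      constructor
      · simp [Memory.setNat_nat]
      · simp [Memory.setNat_nat, h6]
      · simp [Memory.setNat_nat, h7]
      · simpa using hf
      · simp [Memory.setNat_nat, h2]
      · simp [Memory.setNat_nat, h3]
      · intro a _ _ ha _ _
        exact Memory.setNat_nat_ne _ _ _ ha
      · intro a _
        rfl)
  refine ⟨s', _, .seq (.natStore _ _ _ _) hr, ?_, hI⟩
  simp only [Test.cost, NExpr.cost, RExpr.cost] at ht ⊢
  omega

/-- Writes the shifts and computes the tables. -/
def prepareProgram (d C : ℕ) : Program :=
  .seq (.realStore d (.lit 1) (.lit 3)) <| .seq (.realStore d (.lit 2) (.lit (-3))) <|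
    .seq (countProgram 1 (d + 1)) <| .seq (.setR (d + 2) (.lit 3)) <|
      .seq (countProgram 0 (d + 2)) <|
        .seq (.setR (d + 4) (RExpr.pow (.var (d + 2)) (4 * d + 1))) <|
          .seq (boundProgram d C) (tableProgram d)

/-- The memory holds the input and tables for facts below `V`, and no fact is marked. -/
structure Prepared {d n : ℕ} (c : Fin n → EuclideanSpace ℝ (Fin d)) (k V : ℕ) (s : Memory) :
    Prop where
  size : s.nat 0 0 = n
  count : s.nat 0 1 = k
  bound : s.nat 5 0 = V
  unmarked : ∀ f, s.nat 4 f = 0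
  coord : ∀ (j : Fin d) (p : Fin n), s.real j p = c p j
  shift_zero : s.real d 0 = 0
  shift_one : s.real d 1 = 3
  shift_two : s.real d 2 = -3
  encodes : (tablesOf d s).Encodes (n + 3) V
  head_zero : s.nat 2 0 = 0
  tail_le : ∀ g, s.nat 3 g ≤ g
  tail_lt : ∀ g, g ≠ 0 → s.nat 3 g < g

theorem prepareProgram_runs {d n : ℕ} (hd : 0 < d) (C k : ℕ)
    (c : Fin n → EuclideanSpace ℝ (Fin d)) :
    ∃ s t, Runs (prepareProgram d C) (input c k) s t ∧
      t ≤ 19 * k + 19 * n + listLength d C k * ((lengthTest d C).cost + 14) +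
        47 * (n + 3) ^ (4 * d + 1 + listLength d C k) +
        ((lengthTest d C).cost + (RExpr.pow (.var (d + 2)) (4 * d + 1)).cost + 50) ∧
      Prepared c k ((n + 3) ^ (4 * d + 1 + listLength d C k)) s := by
  set M := listLength d C k with hM
  set V := (n + 3) ^ (4 * d + 1 + M) with hV
  have i0 : (input c k).nat 0 0 = n := by simp [input]
  have i1 : (input c k).nat 0 1 = k := by simp [input]
  have ia : ∀ a, a ≠ 0 → ∀ i, (input c k).nat a i = 0 := fun a ha i => by simp [input, ha]
  have ir : ∀ a, d ≤ a → ∀ i, (input c k).real a i = 0 := fun a ha i => by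
    simp only [input]; rw [dif_neg (by omega)]
  have hr1 := Runs.realStore (input c k) d (.lit 1) (.lit 3)
  set s₁ := (input c k).setReal d ((NExpr.lit 1).eval (input c k)) ((RExpr.lit 3).eval (input c k))
    with hs₁
  have hr2 := Runs.realStore s₁ d (.lit 2) (.lit (-3))
  set s₂ := s₁.setReal d ((NExpr.lit 2).eval s₁) ((RExpr.lit (-3)).eval s₁) with hs₂
  have n2 : s₂.nat = (input c k).nat := rfl
  have r2 : ∀ a i, s₂.real a i = if a = d ∧ i = 2 then -3 else if a = d ∧ i = 1 then 3 else
      (input c k).real a i := by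
    intro a i
    rw [hs₂, Memory.setReal_real, hs₁, Memory.setReal_real]
    simp [NExpr.eval, RExpr.eval]
  obtain ⟨s₃, t₃, hr3, ht3, n3, r3, v3⟩ := countProgram_runs 1 (d + 1) s₂
  have hr4 := Runs.realStore s₃ (d + 2) (.lit 0) (.lit 3)
  set s₄ := s₃.setReal (d + 2) ((NExpr.lit 0).eval s₃) ((RExpr.lit 3).eval s₃) with hs₄
  have r4 : ∀ a i, s₄.real a i = if a = d + 2 ∧ i = 0 then 3 else s₃.real a i := by
    intro a i
    rw [hs₄, Memory.setReal_real]
    simp [NExpr.eval, RExpr.eval]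
  have n4 : s₄.nat = s₃.nat := rfl
  obtain ⟨s₅, t₅, hr5, ht5, n5, r5, v5⟩ := countProgram_runs 0 (d + 2) s₄
  have hr6 := Runs.realStore s₅ (d + 4) (.lit 0) (RExpr.pow (.var (d + 2)) (4 * d + 1))
  have e6 : (RExpr.pow (.var (d + 2)) (4 * d + 1)).eval s₅ = s₅.real (d + 2) 0 ^ (4 * d + 1) := by
    rw [RExpr.pow_eval]; rfl
  rw [e6] at hr6
  set s₆ := s₅.setReal (d + 4) ((NExpr.lit 0).eval s₅) (s₅.real (d + 2) 0 ^ (4 * d + 1)) with hs₆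
  have r6 : ∀ a i, s₆.real a i = if a = d + 4 ∧ i = 0 then s₅.real (d + 2) 0 ^ (4 * d + 1) else
      s₅.real a i := fun a i => Memory.setReal_real _ _ _ _ _ _
  have n6 : s₆.nat = s₅.nat := rfl
  have nat6 : ∀ a, a ≠ 5 → s₆.nat a = (input c k).nat a := fun a ha => by
    rw [n6, n5 a ha, n4, n3 a ha, n2]
  have c1 : s₂.nat 0 1 = k := by rw [n2, i1]
  have c0 : s₄.nat 0 0 = n := by rw [n4, n3 0 (by omega), n2, i0]
  have q2 : s₅.real (d + 2) 0 = ((n + 3 : ℕ) : ℝ) := by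
    rw [v5, r4, if_pos ⟨rfl, rfl⟩, c0]; push_cast; ring
  have q1 : s₆.real (d + 1) 0 = k := by
    rw [r6, if_neg (by omega), r5 _ (by omega), r4, if_neg (by omega), v3, r2, if_neg (by omega),
      if_neg (by omega), ir _ (by omega), c1, zero_add]
  have q2' : s₆.real (d + 2) 0 = ((n + 3 : ℕ) : ℝ) := by rw [r6, if_neg (by omega), q2]
  have q3 : s₆.real (d + 3) 0 = 0 := by
    rw [r6, if_neg (by omega), r5 _ (by omega), r4, if_neg (by omega), r3 _ (by omega), r2,
      if_neg (by omega), if_neg (by omega), ir _ (by omega)]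
  have q5 : s₆.real (d + 5) 0 = 0 := by
    rw [r6, if_neg (by omega), r5 _ (by omega), r4, if_neg (by omega), r3 _ (by omega), r2,
      if_neg (by omega), if_neg (by omega), ir _ (by omega)]
  have q4 : s₆.real (d + 4) 0 = ((n + 3 : ℕ) : ℝ) ^ (4 * d + 1) := by
    rw [r6, if_pos ⟨rfl, rfl⟩, q2]
  obtain ⟨s₇, t₇, hr7, ht7, n7, r7, v7⟩ := boundProgram_runs (C := C) hd q1 q2' q3
  have w4 : s₇.real (d + 4) 0 = (V : ℕ) := by
    rw [v7, q4, hV]; push_cast; rw [← pow_add]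
  have nat7 : ∀ a, a ≠ 5 → s₇.nat a = (input c k).nat a := fun a ha => by rw [n7, nat6 a ha]
  obtain ⟨s₈, t₈, hr8, ht8, H⟩ := tableProgram_runs (d := d) (n := n) (V := V) (s := s₇)
    (by rw [nat7 0 (by omega), i0]) w4 (by rw [r7 _ (by omega) (by omega), q5])
    (fun g => by rw [nat7 2 (by omega), ia 2 (by omega)])
    (fun g => by rw [nat7 3 (by omega), ia 3 (by omega)])
    (by rw [nat7 6 (by omega), ia 6 (by omega)]) (by rw [nat7 7 (by omega), ia 7 (by omega)])
  have nat8 : ∀ a, a = 0 ∨ a = 4 → s₈.nat a = (input c k).nat a := fun a ha => by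
    rw [H.nat a (by omega) (by omega) (by omega) (by omega) (by omega), nat7 a (by omega)]
  -- Centres and shifts occupy the real arrays up to `d`, while all working variables lie above.
  have real8 : ∀ a, a ≤ d → s₈.real a = s₂.real a := fun a ha => by
    rw [H.real a (by omega), r7 a (by omega) (by omega)]
    funext i
    rw [r6, if_neg (by omega), r5 _ (by omega), r4, if_neg (by omega), r3 _ (by omega)]
  refine ⟨s₈, _, .seq hr1 (.seq hr2 (.seq hr3 (.seq hr4 (.seq hr5 (.seq hr6 (.seq hr7 hr8)))))),
    ?_, ?_⟩
  · rw [c1] at ht3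
    rw [c0] at ht5
    rw [← hM] at ht7
    simp only [NExpr.cost, RExpr.cost]
    omega
  -- Beyond the filled part the table is `0`, so the estimate, and with it the termination of
  -- chains, holds for every `g`.
  · have tail_le : ∀ g, s₈.nat 3 g ≤ g / (n + 3) := fun g => by
      rw [H.tail]; split_ifs
      · exact le_rfl
      · exact Nat.zero_le _
    refine ⟨?_, ?_, H.index, ?_, ?_, ?_, ?_, ?_, ⟨by omega, ?_, ?_⟩, ?_, ?_, ?_⟩
    · rw [nat8 0 (.inl rfl), i0]
    · rw [nat8 0 (.inl rfl), i1]
    · intro f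
      rw [nat8 4 (.inr rfl), ia 4 (by omega)]
    · intro j p
      have := j.2
      rw [real8 j (by omega), r2, if_neg (by omega), if_neg (by omega)]
      simp [input]
    · rw [real8 d le_rfl, r2, if_neg (by omega), if_neg (by omega), ir d le_rfl]
    · rw [real8 d le_rfl, r2, if_neg (by omega), if_pos ⟨rfl, rfl⟩]
    · rw [real8 d le_rfl, r2, if_pos ⟨rfl, rfl⟩]
    · intro g hg
      exact (H.head g).trans (if_pos hg)
    · intro g hg
      exact (H.tail g).trans (if_pos hg)
    · rw [H.head]; simp
    · exact fun g => (tail_le g).trans (Nat.div_le_self _ _)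
    · exact fun g hg => (tail_le g).trans_lt (Nat.div_lt_self (by omega) (by omega))

end Packing

/-! ### The packing program -/

namespace Packing

open RealRAM

section program

variable {d : ℕ} (R : Conflict d)

/-- Marks the fact in variable `7` if it can be derived, and goes on to the next one. -/
def markBody : Program :=
  .seq ((derivesFormula R).compile 8) <|
    .seq (.branch (.natEq (.var 1) (.lit 1)) (.natStore 4 (.var 7) (.lit 1)) .skip)
      (.setN 7 (.sub (.var 7) (.lit 1)))

def sweepProgram : Program :=
  .seq (.setN 7 (.var 5)) (.loop (.not (.natEq (.var 7) (.lit 0))) (markBody R))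

/-- The completeness argument derives a packing of `k` points within `k` rounds, so no test for
saturation is needed. -/
def roundsProgram : Program :=
  .seq (.setN 6 (.load 0 (.lit 1))) <| .loop (.not (.natEq (.var 6) (.lit 0))) <|
    .seq (sweepProgram R) (.setN 6 (.sub (.var 6) (.lit 1)))

def solveProgram (C : ℕ) : Program :=
  .seq (prepareProgram d C) <| .seq (roundsProgram R) <|
    .seq (answerFormula.compile 8) (.setN 0 (.var 1))

/-- Decides whether there are `k` points without conflict. -/
def packingProgram (C : ℕ) : Program :=
  .branch (.natEq (.load 0 (.lit 1)) (.lit 0)) (.setN 0 (.lit 1)) <|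
    .branch (.natLE (.load 0 (.lit 1)) (.load 0 (.lit 0))) (solveProgram R C) (.setN 0 (.lit 0))

end program

/-- Everything but marks and working variables is as in the memory `s`. -/
structure Same (s u : Memory) : Prop where
  real : u.real = s.real
  nat : ∀ a, a = 0 ∨ a = 2 ∨ a = 3 ∨ a = 5 → u.nat a = s.nat a

theorem Same.tablesOf_eq {s u : Memory} (h : Same s u) (d : ℕ) : tablesOf d u = tablesOf d s := by
  simp [tablesOf, h.real, h.nat 2 (by simp), h.nat 3 (by simp)]

theorem Same.of_agree {s u u' : Memory} (h : Same s u) (ha : Agree 8 u u') : Same s u' :=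
  ⟨ha.real.trans h.real, fun a h' => (ha.nat a (by omega) (by omega)).trans (h.nat a h')⟩

theorem Same.setNat {s u : Memory} (h : Same s u) {a : ℕ} (i v : ℕ) (h0 : a ≠ 0) (h2 : a ≠ 2)
    (h3 : a ≠ 3) (h5 : a ≠ 5) : Same s (u.setNat a i v) :=
  ⟨h.real, fun b hb => by rw [Memory.setNat_nat_ne _ _ _ (by omega)]; exact h.nat b hb⟩

/-! ### Invariants of sweeps and rounds -/

section rounds

variable {d n k V : ℕ} {c : Fin n → EuclideanSpace ℝ (Fin d)} {s : Memory}

/-- `F` is marked, everything derivable from `F` above `V - i` is marked, and marked facts are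
valid. -/
structure SweepInv (R : Conflict d) (n V r : ℕ) (s : Memory) (F : Set ℕ) (i : ℕ) (u : Memory) :
    Prop where
  same : Same s u
  round : u.nat 6 0 = r
  index : u.nat 7 0 = V - i
  subset : F ⊆ marks u
  marked : ∀ f, V - i < f → f ≤ V → (tablesOf d s).Derives d n V R.rel F f → f ∈ marks u
  valid : ∀ f ∈ marks u, (tablesOf d s).Valid d n R.rel f

/-- Marks set earlier in a sweep may already serve as premises. This is harmless: they are valid,
and derivability is monotone in the set of premises. -/
theorem markBody_runs (R : Conflict d) (hs : Prepared c k V s) {r i : ℕ} (hi : i < V) {F : Set ℕ}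
    {u : Memory} (h : SweepInv R n V r s F i u) :
    ∃ u' t, Runs (markBody R) u u' t ∧ t ≤ (derivesFormula R).costBound V + 15 ∧
      SweepInv R n V r s F (i + 1) u' := by
  obtain ⟨hsame, h6, h7, hF, hm, hv⟩ := h
  have hu3 : u.nat 3 = s.nat 3 := hsame.nat 3 (by simp)
  have hu5 : u.nat 5 0 = V := by rw [hsame.nat 5 (by simp), hs.bound]
  have hu0 : u.nat 0 0 = n := by rw [hsame.nat 0 (by simp), hs.size]
  have hbd := bounded_derivesFormula R (s := u) (by rw [hu3]; exact hs.tail_le) (by omega)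
  rw [hu5] at hbd
  obtain ⟨u₁, t₁, hr₁, ht₁, ha, h1⟩ := (derivesFormula R).compile_runs 8 u (by norm_num)
    (below_derivesFormula R) (by rw [hu3]; exact hs.tail_lt) hbd u (Agree.refl _ _)
  have hiff := holds_derivesFormula R u
  rw [hsame.tablesOf_eq, hu0, hu5, h7] at hiff
  have hsame₁ := hsame.of_agree ha
  have m₁ : marks u₁ = marks u := by simp only [marks, ha.nat 4 (by norm_num) (by norm_num)]
  have i₁ : u₁.nat 7 0 = V - i := by rw [ha.nat 7 (by norm_num) (by norm_num), h7]
  have r₁ : u₁.nat 6 0 = r := by rw [ha.nat 6 (by norm_num) (by norm_num), h6]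
  by_cases hD : (derivesFormula R).Holds 8 u
  · have hder := hiff.1 hD
    refine ⟨_, _, .seq hr₁ (.seq (.branchTrue ?_ (.natStore _ _ _ _)) (.natStore _ _ _ _)), ?_,
      (hsame₁.setNat _ _ (by omega) (by omega) (by omega) (by omega)).setNat _ _ (by omega)
        (by omega) (by omega) (by omega), ?_, ?_, ?_, ?_, ?_⟩
    · simp [Test.Holds, NExpr.eval, h1, hD]
    · simp only [Test.cost, NExpr.cost]; omega
    · simp [Memory.setNat_nat, r₁]
    · simp [Memory.setNat_nat, NExpr.eval, i₁]; omega
    all_goals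
      have hmk : ∀ f, f ∈ marks ((u₁.setNat 4 ((NExpr.var 7).eval u₁)
          ((NExpr.lit 1).eval u₁)).setNat 7 ((NExpr.lit 0).eval
            (u₁.setNat 4 ((NExpr.var 7).eval u₁) ((NExpr.lit 1).eval u₁)))
          ((NExpr.sub (.var 7) (.lit 1)).eval
            (u₁.setNat 4 ((NExpr.var 7).eval u₁) ((NExpr.lit 1).eval u₁)))) ↔
          f = V - i ∨ f ∈ marks u := by
        intro f
        rw [← m₁]
        simp only [marks, Set.mem_ofPred_eq, Memory.setNat_nat, NExpr.eval, i₁]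
        by_cases hf : f = V - i <;> simp [hf]
    · intro f hf
      exact (hmk f).2 (.inr (hF hf))
    · intro f hf hfV hfd
      refine (hmk f).2 ?_
      by_cases hfi : f = V - i
      · exact .inl hfi
      · exact .inr (hm f (by omega) hfV hfd)
    · intro f hf
      rcases (hmk f).1 hf with rfl | hf
      · refine Tables.valid_of_derives hs.head_zero R.symm R.close hv hder
      · exact hv f hf
  · have hder := mt hiff.2 hD
    refine ⟨_, _, .seq hr₁ (.seq (.branchFalse ?_ (.skip _)) (.natStore _ _ _ _)), ?_,
      hsame₁.setNat _ _ (by omega) (by omega) (by omega) (by omega), ?_, ?_, ?_, ?_, ?_⟩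
    · simp [Test.Holds, NExpr.eval, h1, hD]
    · simp only [Test.cost, NExpr.cost]; omega
    · simp [Memory.setNat_nat, r₁]
    · simp [Memory.setNat_nat, NExpr.eval, i₁]; omega
    all_goals
      have hmk : marks (u₁.setNat 7 ((NExpr.lit 0).eval u₁)
          ((NExpr.sub (.var 7) (.lit 1)).eval u₁)) = marks u := by
        rw [← m₁]
        simp only [marks, Memory.setNat_nat_ne _ _ _ (show (4 : ℕ) ≠ 7 by norm_num)]
      rw [hmk]
    · exact hF
    · intro f hf hfV hfd
      by_cases hfi : f = V - i
      · subst hfi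
        -- What cannot be derived from the current marks cannot be derived from the smaller set `F`.
        exact absurd (hfd.mono hF) hder
      · exact hm f (by omega) hfV hfd
    · exact hv

/-- After `i` rounds all facts derivable in `i` rounds are marked. -/
structure RoundInv (R : Conflict d) (n V k : ℕ) (s : Memory) (i : ℕ) (u : Memory) : Prop where
  same : Same s u
  round : u.nat 6 0 = k - i
  subset : (tablesOf d s).derivable d n V R.rel i ⊆ marks u
  valid : ∀ f ∈ marks u, (tablesOf d s).Valid d n R.rel f

theorem sweepProgram_runs (R : Conflict d) (hs : Prepared c k V s) {i : ℕ} {u : Memory}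
    (h : RoundInv R n V k s i u) :
    ∃ u' t, Runs (sweepProgram R) u u' t ∧
      t ≤ V * ((derivesFormula R).costBound V + 21) + 10 ∧ Same s u' ∧ u'.nat 6 0 = k - i ∧
      (tablesOf d s).derivable d n V R.rel (i + 1) ⊆ marks u' ∧
      ∀ f ∈ marks u', (tablesOf d s).Valid d n R.rel f := by
  obtain ⟨hsame, h6, hF, hv⟩ := h
  have hu5 : u.nat 5 0 = V := by rw [hsame.nat 5 (by simp), hs.bound]
  have hmk : marks (u.setNat 7 0 V) = marks u := by
    simp only [marks, Memory.setNat_nat_ne _ _ _ (show (4 : ℕ) ≠ 7 by norm_num)]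
  have hr0 := Runs.natStore u 7 (.lit 0) (.var 5)
  have he : (NExpr.var 5).eval u = V := hu5
  rw [he] at hr0
  obtain ⟨u', t, hr, ht, hI⟩ := Runs.loop_count (m := V)
    (T := (derivesFormula R).costBound V + 15) (b := .not (.natEq (.var 7) (.lit 0)))
    (p := markBody R) (SweepInv R n V (k - i) s ((tablesOf d s).derivable d n V R.rel i))
    (s := u.setNat 7 0 V) (by
      intro l hl w hw
      refine ⟨?_, markBody_runs R hs hl hw⟩
      simp [Test.Holds, NExpr.eval, hw.index]
      omega)
    (by
      intro w hw
      simp [Test.Holds, NExpr.eval, hw.index])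
    (by
      refine ⟨hsame.setNat _ _ (by omega) (by omega) (by omega) (by omega), ?_, ?_, ?_, ?_, ?_⟩
      · simp [Memory.setNat_nat, h6]
      · simp [Memory.setNat_nat]
      · rw [hmk]; exact hF
      · intro f h1 h2
        omega
      · rw [hmk]; exact hv)
  refine ⟨u', _, .seq hr0 hr, ?_, hI.same, hI.round, ?_, hI.valid⟩
  · have e : (derivesFormula R).costBound V + 15 +
        (Test.not (.natEq (.var 7) (.lit 0))).cost + 1 = (derivesFormula R).costBound V + 21 := rfl
    rw [e] at ht
    simp only [Test.cost, NExpr.cost] at ht ⊢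
    omega
  · rintro f ⟨hf1, hf2⟩
    exact hI.marked f (by omega) hf1.2 hf2

theorem roundsProgram_runs (R : Conflict d) (hs : Prepared c k V s) :
    ∃ u t, Runs (roundsProgram R) s u t ∧
      t ≤ k * (V * ((derivesFormula R).costBound V + 21) + 22) + 10 ∧ RoundInv R n V k s k u := by
  have hr0 := Runs.natStore s 6 (.lit 0) (.load 0 (.lit 1))
  have he : (NExpr.load 0 (.lit 1)).eval s = k := hs.count
  rw [he] at hr0
  obtain ⟨u', t, hr, ht, hI⟩ := Runs.loop_count (m := k)
    (T := V * ((derivesFormula R).costBound V + 21) + 16) (b := .not (.natEq (.var 6) (.lit 0)))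
    (p := .seq (sweepProgram R) (.setN 6 (.sub (.var 6) (.lit 1)))) (RoundInv R n V k s)
    (s := s.setNat 6 0 k) (by
      intro i hi u hu
      obtain ⟨u', t, hr, ht, h1, h2, h3, h4⟩ := sweepProgram_runs R hs hu
      have hmk : ∀ v, marks (u'.setNat 6 0 v) = marks u' := fun v => by
        simp only [marks, Memory.setNat_nat_ne _ _ _ (show (4 : ℕ) ≠ 6 by norm_num)]
      refine ⟨?_, _, _, .seq hr (.natStore _ _ _ _), ?_,
        h1.setNat _ _ (by omega) (by omega) (by omega) (by omega), ?_, ?_, ?_⟩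
      · simp [Test.Holds, NExpr.eval, hu.round]
        omega
      · simp only [NExpr.cost]; omega
      · simp [Memory.setNat_nat, NExpr.eval, h2]; omega
      · exact h3.trans (hmk _).ge
      · intro f hf
        exact h4 f ((hmk _).le hf))
    (by
      intro u hu
      simp [Test.Holds, NExpr.eval, hu.round])
    (by
      have hS : Same s s := ⟨rfl, fun _ _ => rfl⟩
      refine ⟨hS.setNat _ _ (by omega) (by omega) (by omega) (by omega), ?_, ?_, ?_⟩
      · simp [Memory.setNat_nat]
      · exact Set.empty_subset _
      · intro f hf
        have : s.nat 4 f = 1 := by simpa [marks, Memory.setNat_nat] using hf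
        rw [hs.unmarked] at this
        omega)
  refine ⟨u', _, .seq hr0 hr, ?_, hI⟩
  have e : V * ((derivesFormula R).costBound V + 21) + 16 +
      (Test.not (.natEq (.var 6) (.lit 0))).cost + 1 =
      V * ((derivesFormula R).costBound V + 21) + 22 := rfl
  rw [e] at ht
  simp only [Test.cost, NExpr.cost] at ht ⊢
  omega

end rounds

/-! ### From bodies to conflicts, and correctness of the answer -/

/-- The bodies `B x` and `B y` meet if and only if `x` and `y` are in conflict. -/
def Conflict.Describes {d : ℕ} (R : Conflict d)
    (B : EuclideanSpace ℝ (Fin d) → Set (EuclideanSpace ℝ (Fin d))) : Prop :=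
  ∀ (x y : EuclideanSpace ℝ (Fin d)) (u v : ℕ → ℝ), (∀ j : Fin d, u j = x j) →
    (∀ j : Fin d, v j = y j) → (Disjoint (B x) (B y) ↔ ¬ R.rel u v)

theorem hasPacking_iff {d n k V : ℕ} {R : Conflict d}
    {B : EuclideanSpace ℝ (Fin d) → Set (EuclideanSpace ℝ (Fin d))} (hR : R.Describes B)
    {c : Fin n → EuclideanSpace ℝ (Fin d)} {s : Memory} (hs : Prepared c k V s) :
    HasPacking B c k ↔
      ∃ S ⊆ Finset.range n, S.card = k ∧ (tablesOf d s).IsPacking R.rel S := by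
  have key : ∀ p q : Fin n, Disjoint (B (c p)) (B (c q)) ↔
      ¬ R.rel ((tablesOf d s).pt p) ((tablesOf d s).pt q) := fun p q =>
    hR _ _ _ _ (fun j => hs.coord j p) (fun j => hs.coord j q)
  constructor
  · rintro ⟨S, hcard, hS⟩
    refine ⟨S.map Fin.valEmbedding, ?_, by rw [Finset.card_map, hcard], ?_⟩
    · intro p hp
      obtain ⟨p, _, rfl⟩ := Finset.mem_map.1 hp
      simp
    · intro p hp q hq hpq
      obtain ⟨p, hp', rfl⟩ := Finset.mem_map.1 hp
      obtain ⟨q, hq', rfl⟩ := Finset.mem_map.1 hq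
      exact (key p q).1 (hS hp' hq' fun h => hpq (by rw [h]))
  · rintro ⟨S, hSn, hcard, hS⟩
    have hlt : ∀ p ∈ S, p < n := fun p hp => Finset.mem_range.1 (hSn hp)
    refine ⟨S.attachFin hlt, by rw [Finset.card_attachFin, hcard], ?_⟩
    intro p hp q hq hpq
    have hp' : (p : ℕ) ∈ S := by simpa using hp
    have hq' : (q : ℕ) ∈ S := by simpa using hq
    exact (key p q).2 (hS p hp' q hq' fun h => hpq (Fin.ext h))

/-- The constant in the length of the lists of points in facts. -/
def lengthConst (d : ℕ) : ℕ := 2 * d * cutConst d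

theorem listLength_pos {d k : ℕ} (hd : 0 < d) (hk : 0 < k) :
    0 < listLength d (lengthConst d) k := by
  have : 0 < lengthConst d := by unfold lengthConst cutConst; positivity
  exact Nat.ceil_pos.2 (by positivity)

theorem Prepared.complete {d n k : ℕ} (hd : 0 < d) (hk : 0 < k) (R : Conflict d)
    {c : Fin n → EuclideanSpace ℝ (Fin d)} {s : Memory}
    (hs : Prepared c k ((n + 3) ^ (4 * d + 1 + listLength d (lengthConst d) k)) s) :
    (tablesOf d s).Complete d n k (listLength d (lengthConst d) k) R.rel where
  encodes := hs.encodes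
  shift_zero := hs.shift_zero
  shift_one := hs.shift_one
  shift_two := hs.shift_two
  dim_pos := hd
  length_pos := listLength_pos hd hk
  length := by
    refine le_trans (le_of_eq ?_) (Nat.le_ceil _)
    rw [lengthConst]; push_cast; ring
  separated := R.separated

/-- A marked fact with count `k` is valid and so supplies a packing; conversely a packing supplies a
fact with count `k` derivable in `k` rounds, and this fact is marked. -/
theorem solveProgram_runs {d n k : ℕ} (hd : 0 < d) (hk : 0 < k) {R : Conflict d}
    {B : EuclideanSpace ℝ (Fin d) → Set (EuclideanSpace ℝ (Fin d))} (hR : R.Describes B)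
    (c : Fin n → EuclideanSpace ℝ (Fin d)) {M V : ℕ} (hM : M = listLength d (lengthConst d) k)
    (hV : V = (n + 3) ^ (4 * d + 1 + M)) :
    ∃ s t, Runs (solveProgram R (lengthConst d)) (input c k) s t ∧
      (HasPacking B c k → output s = 1) ∧ (¬ HasPacking B c k → output s = 0) ∧
      t ≤ 19 * k + 19 * n + M * ((lengthTest d (lengthConst d)).cost + 14) + 47 * V +
        k * (V * ((derivesFormula R).costBound V + 21) + 22) + answerFormula.costBound V +
        ((lengthTest d (lengthConst d)).cost +
          (RExpr.pow (.var (d + 2)) (4 * d + 1)).cost + 70) := by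
  subst hV hM
  obtain ⟨s₁, t₁, hr₁, ht₁, hs⟩ := prepareProgram_runs hd (lengthConst d) k c
  set M := listLength d (lengthConst d) k
  set V := (n + 3) ^ (4 * d + 1 + M)
  obtain ⟨s₂, t₂, hr₂, ht₂, hI⟩ := roundsProgram_runs R hs
  have h3 : s₂.nat 3 = s₁.nat 3 := hI.same.nat 3 (by simp)
  have h5 : s₂.nat 5 0 = V := by rw [hI.same.nat 5 (by simp), hs.bound]
  have hbd := bounded_answerFormula s₂
  rw [h5] at hbd
  obtain ⟨s₃, t₃, hr₃, ht₃, ha, h1⟩ := answerFormula.compile_runs 8 s₂ (by norm_num)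
    below_answerFormula (by rw [h3]; exact hs.tail_lt) hbd s₂ (Agree.refl _ _)
  have hiff : answerFormula.Holds 8 s₂ ↔ HasPacking B c k := by
    rw [holds_answerFormula d, hI.same.tablesOf_eq, h5, hI.same.nat 0 (by simp), hs.count,
      hasPacking_iff hR hs]
    constructor
    · rintro ⟨f, _, hf, hk⟩
      obtain ⟨P, hP, hcard, hpack, _⟩ := hI.valid f hf
      exact ⟨P, hP, hcard.trans hk, hpack⟩
    · rintro ⟨S, hS, hcard, hpack⟩
      obtain ⟨f, hf, hfk⟩ := (hs.complete hd hk R).exists_derivable hk hS hpack hcard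
      refine ⟨f, ?_, hI.subset hf, hfk⟩
      -- For a successor, membership in `derivable` unfolds and gives the range `1 ≤ f ≤ V`.
      cases k with
      | zero => exact absurd hk (by omega)
      | succ k => exact hf.1
  refine ⟨_, _, .seq hr₁ (.seq hr₂ (.seq hr₃ (.natStore _ _ _ _))), ?_, ?_, ?_⟩
  · intro h
    simp [output, Memory.setNat_nat, NExpr.eval, h1, hiff, h]
  · intro h
    simp [output, Memory.setNat_nat, NExpr.eval, h1, hiff, h]
  · simp only [NExpr.cost]
    omega

/-! ### Running time -/

/-- The rounds and the sweep contribute one factor up to `V + 1` each, which accounts for the `2` in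
the exponent; the rest is the cost of the two fixed formulas. -/
theorem time_poly (φ ψ : Formula) (a b : ℕ) : ∃ A m : ℕ, ∀ k n M V : ℕ, k ≤ V → n ≤ V → M ≤ V →
    19 * k + 19 * n + M * a + 47 * V + k * (V * (φ.costBound V + 21) + 22) + ψ.costBound V + b ≤
      A * (V + 1) ^ m := by
  obtain ⟨A₁, m₁, h₁⟩ := φ.costBound_poly
  obtain ⟨A₂, m₂, h₂⟩ := ψ.costBound_poly
  refine ⟨19 + 19 + a + 47 + (A₁ + 43) + A₂ + b, m₁ + m₂ + 2, fun k n M V hk hn hM => ?_⟩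
  set X := V + 1 with hX
  set Y := X ^ (m₁ + m₂ + 2) with hY
  have hX1 : 1 ≤ X := by omega
  have hXY : X ≤ Y := Nat.le_self_pow (by omega) X
  have hm₁ : 1 ≤ X ^ m₁ := Nat.one_le_pow _ _ hX1
  have e1 : φ.costBound V + 21 ≤ (A₁ + 21) * X ^ m₁ := by
    have := h₁ V
    rw [← hX] at this
    linarith
  have e2 : V * (φ.costBound V + 21) + 22 ≤ (A₁ + 43) * X ^ (m₁ + 1) := by
    calc V * (φ.costBound V + 21) + 22 ≤ X * ((A₁ + 21) * X ^ m₁) + 22 * X ^ (m₁ + 1) :=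
          add_le_add (Nat.mul_le_mul (by omega) e1)
            (Nat.le_mul_of_pos_right _ (Nat.one_le_pow _ _ hX1))
      _ = (A₁ + 43) * X ^ (m₁ + 1) := by ring
  have e3 : k * (V * (φ.costBound V + 21) + 22) ≤ (A₁ + 43) * Y := by
    calc k * (V * (φ.costBound V + 21) + 22) ≤ X * ((A₁ + 43) * X ^ (m₁ + 1)) :=
          Nat.mul_le_mul (by omega) e2
      _ = (A₁ + 43) * X ^ (m₁ + 2) := by ring
      _ ≤ (A₁ + 43) * Y := Nat.mul_le_mul_left _ (Nat.pow_le_pow_right hX1 (by omega))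
  have e4 : ψ.costBound V ≤ A₂ * Y :=
    (h₂ V).trans (Nat.mul_le_mul_left _ (Nat.pow_le_pow_right hX1 (by omega)))
  have e5 : M * a ≤ a * Y := by rw [mul_comm]; exact Nat.mul_le_mul_left _ (by omega)
  have e6 : b * 1 ≤ b * Y := Nat.mul_le_mul_left _ (by omega)
  have e7 : (19 + 19 + a + 47 + (A₁ + 43) + A₂ + b) * Y =
      19 * Y + 19 * Y + a * Y + 47 * Y + (A₁ + 43) * Y + A₂ * Y + b * Y := by ring
  rw [e7]
  have f1 : 19 * k ≤ 19 * Y := by omega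
  have f2 : 19 * n ≤ 19 * Y := by omega
  have f3 : 47 * V ≤ 47 * Y := by omega
  linarith

/-- Here `n + 3 ≤ 4 * n`, and a further factor `2 ^ W` absorbs the summand `1`. -/
theorem succ_pow_le {n W : ℕ} (hn : 1 ≤ n) (hW : 1 ≤ W) : (n + 3) ^ W + 1 ≤ (8 * n) ^ W := by
  have h1 : 1 ≤ (n + 3) ^ W := Nat.one_le_pow _ _ (by omega)
  have h2 : 2 ≤ 2 ^ W := Nat.le_self_pow (by omega) 2
  calc (n + 3) ^ W + 1 ≤ 2 ^ W * (n + 3) ^ W := by nlinarith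
    _ = (2 * (n + 3)) ^ W := (mul_pow _ _ _).symm
    _ ≤ (8 * n) ^ W := Nat.pow_le_pow_left (by omega) W

/-- A power of the number of facts is at most `n ^ O(k ^ (1 - 1 / d))`. -/
theorem pow_bound {d : ℕ} (hd : 2 ≤ d) (A m L : ℕ) : ∃ C : ℝ, 0 ≤ C ∧ ∀ n k : ℕ, 1 ≤ k → k ≤ n →
    (A : ℝ) * (((n + 3) ^ (4 * d + 1 + listLength d L k) + 1 : ℕ) : ℝ) ^ m ≤
      C * (n : ℝ) ^ (C * (k : ℝ) ^ (1 - 1 / (d : ℝ))) := by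
  set w : ℕ := (4 * d + 2 + L) * m with hw
  -- The first summand serves as the factor, including the case `n = 1`; the second serves as the
  -- exponent, by `8 * n ≤ n ^ 4` for `n ≥ 2`.
  refine ⟨A * 8 ^ w + 4 * w, by positivity, fun n k hk hkn => ?_⟩
  set K : ℝ := (k : ℝ) ^ (1 - 1 / (d : ℝ)) with hK
  have hd' : (1 : ℝ) / d ≤ 1 := by
    rw [div_le_one (by positivity)]; exact_mod_cast (show 1 ≤ d by omega)
  have hK1 : 1 ≤ K := Real.one_le_rpow (by exact_mod_cast hk) (by linarith)
  have hn1 : (1 : ℝ) ≤ n := by exact_mod_cast hk.trans hkn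
  set W := 4 * d + 1 + listLength d L k with hW
  have hWK : (W : ℝ) ≤ (4 * d + 2 + L) * K := by
    have h1 : (listLength d L k : ℝ) < L * K + 1 := Nat.ceil_lt_add_one (by positivity)
    rw [hW]
    push_cast
    nlinarith [show (0 : ℝ) ≤ d by positivity]
  have h1 : (((n + 3) ^ W + 1 : ℕ) : ℝ) ^ m ≤ (8 * (n : ℝ)) ^ (w * K) := by
    have h2 : (((n + 3) ^ W + 1 : ℕ) : ℝ) ≤ (8 * (n : ℝ)) ^ W := by
      exact_mod_cast succ_pow_le (hk.trans hkn) (show 1 ≤ W by omega)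
    calc (((n + 3) ^ W + 1 : ℕ) : ℝ) ^ m ≤ ((8 * (n : ℝ)) ^ W) ^ m := by gcongr
      _ = (8 * (n : ℝ)) ^ ((W * m : ℕ) : ℝ) := by rw [← pow_mul, Real.rpow_natCast]
      _ ≤ (8 * (n : ℝ)) ^ (w * K) := by
        refine Real.rpow_le_rpow_of_exponent_le (by linarith) ?_
        rw [hw]
        push_cast
        nlinarith [show (0 : ℝ) ≤ m by positivity]
  have hA : (0 : ℝ) ≤ A := by positivity
  refine (mul_le_mul_of_nonneg_left h1 hA).trans ?_
  set C : ℝ := A * 8 ^ w + 4 * w with hC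
  have h8 : (1 : ℝ) ≤ 8 ^ w := one_le_pow₀ (by norm_num)
  have hw0 : (0 : ℝ) ≤ w := by positivity
  have hAC : (A : ℝ) * 8 ^ w ≤ C := by linarith
  -- Powers of `1` do not grow, so the constant factor alone must absorb `8 ^ w`; here `k = 1` and
  -- the exponent is bounded.
  by_cases hn : n = 1
  · subst hn
    obtain rfl : k = 1 := by omega
    have : K = 1 := by rw [hK]; simp
    rw [this]
    simpa [Real.rpow_natCast] using hAC
  · have hn2 : (2 : ℝ) ≤ n := by exact_mod_cast (show 2 ≤ n by omega)
    have h8n : 8 * (n : ℝ) ≤ (n : ℝ) ^ (4 : ℝ) := by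
      have h3 : (2 : ℝ) ^ 3 ≤ (n : ℝ) ^ 3 := by gcongr
      have h4 : (n : ℝ) ^ (4 : ℝ) = (n : ℝ) ^ 3 * n := by
        rw [show (4 : ℝ) = ((4 : ℕ) : ℝ) by norm_num, Real.rpow_natCast]; ring
      rw [h4]
      nlinarith
    have h5 : (8 * (n : ℝ)) ^ (w * K) ≤ (n : ℝ) ^ (C * K) := by
      calc (8 * (n : ℝ)) ^ (w * K) ≤ ((n : ℝ) ^ (4 : ℝ)) ^ (w * K) :=
            Real.rpow_le_rpow (by positivity) h8n (by positivity)
        _ = (n : ℝ) ^ (4 * (w * K)) := by rw [← Real.rpow_mul (by positivity)]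
        _ ≤ (n : ℝ) ^ (C * K) := by
          refine Real.rpow_le_rpow_of_exponent_le hn1 ?_
          have : 4 * (w : ℝ) ≤ C := by
            have : 0 ≤ (A : ℝ) * 8 ^ w := by positivity
            linarith
          nlinarith
    have hAC' : (A : ℝ) ≤ C := le_trans (by nlinarith) hAC
    exact mul_le_mul hAC' h5 (by positivity) (by linarith)

theorem exists_program {d : ℕ} (hd : 2 ≤ d) (R : Conflict d)
    (B : EuclideanSpace ℝ (Fin d) → Set (EuclideanSpace ℝ (Fin d))) (hR : R.Describes B) :
    ∃ (P : Program) (C : ℝ), ∀ (n k : ℕ) (c : Fin n → EuclideanSpace ℝ (Fin d)),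
      ∃ (s : Memory) (t : ℕ), Runs P (input c k) s t ∧
        (HasPacking B c k → output s = 1) ∧ (¬ HasPacking B c k → output s = 0) ∧
        (t : ℝ) ≤ C * ((max n 1 : ℕ) : ℝ) ^ (C * (k : ℝ) ^ (1 - 1 / (d : ℝ))) := by
  obtain ⟨A, m, hA⟩ := time_poly (derivesFormula R) answerFormula
    ((lengthTest d (lengthConst d)).cost + 14)
    ((lengthTest d (lengthConst d)).cost + (RExpr.pow (.var (d + 2)) (4 * d + 1)).cost + 70 + 20)
  obtain ⟨C, hC0, hC⟩ := pow_bound hd A m (lengthConst d)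
  refine ⟨packingProgram R (lengthConst d), C + 20, fun n k c => ?_⟩
  have i0 : (input c k).nat 0 0 = n := by simp [input]
  have i1 : (input c k).nat 0 1 = k := by simp [input]
  set K : ℝ := (k : ℝ) ^ (1 - 1 / (d : ℝ)) with hK
  have hK0 : 0 ≤ K := by positivity
  have hmax : (1 : ℝ) ≤ ((max n 1 : ℕ) : ℝ) := by exact_mod_cast le_max_right n 1
  have hsmall : ∀ t : ℕ, t ≤ 20 →
      (t : ℝ) ≤ (C + 20) * ((max n 1 : ℕ) : ℝ) ^ ((C + 20) * K) := by
    intro t ht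
    have h1 : 1 ≤ ((max n 1 : ℕ) : ℝ) ^ ((C + 20) * K) := Real.one_le_rpow hmax (by positivity)
    have h2 : (t : ℝ) ≤ 20 := by exact_mod_cast ht
    nlinarith
  by_cases hk : k = 0
  · refine ⟨_, _, .branchTrue ?_ (.natStore _ _ _ _), ?_, ?_, hsmall _ ?_⟩
    · simpa [Test.Holds, NExpr.eval, i1] using hk
    · simp [output, Memory.setNat_nat, NExpr.eval]
    · intro h
      exact absurd ⟨∅, by simp [hk], by simp⟩ h
    · simp [Test.cost, NExpr.cost]
  -- Too large a `k` is rejected at once. Otherwise `1 ≤ k ≤ n ≤ V`, so the counters are covered by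
  -- the bound in `V`.
  by_cases hkn : k ≤ n
  · obtain ⟨s, t, hr, h1, h2, ht⟩ := solveProgram_runs (by omega) (by omega) hR c (k := k) rfl rfl
    refine ⟨s, _, .branchFalse ?_ (.branchTrue ?_ hr), h1, h2, ?_⟩
    · simp [Test.Holds, NExpr.eval, i1, hk]
    · simp [Test.Holds, NExpr.eval, i0, i1, hkn]
    · set M := listLength d (lengthConst d) k
      set V := (n + 3) ^ (4 * d + 1 + M) with hV
      have hnV : n ≤ V := by
        have : n + 3 ≤ V := Nat.le_self_pow (by omega) _
        omega
      have hMV : M ≤ V := by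
        have h3 : M < 2 ^ M := Nat.lt_two_pow_self
        have h4 : 2 ^ M ≤ (n + 3) ^ M := Nat.pow_le_pow_left (by omega) M
        have h5 : (n + 3) ^ M ≤ V := Nat.pow_le_pow_right (by omega) (by omega)
        omega
      have hpoly := hA k n M V (hkn.trans hnV) hnV hMV
      have hb := hC n k (by omega) hkn
      have hle : (Test.natEq (.load 0 (.lit 1)) (.lit 0)).cost +
          ((Test.natLE (.load 0 (.lit 1)) (.load 0 (.lit 0))).cost + t + 1) + 1 ≤
          A * (V + 1) ^ m := by
        simp only [Test.cost, NExpr.cost]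
        omega
      rw [Nat.max_eq_left (show 1 ≤ n by omega)] at hmax ⊢
      have hle' : ((A * (V + 1) ^ m : ℕ) : ℝ) ≤ C * (n : ℝ) ^ (C * K) := by
        rw [Nat.cast_mul, Nat.cast_pow]; exact hb
      have hexp : (n : ℝ) ^ (C * K) ≤ (n : ℝ) ^ ((C + 20) * K) :=
        Real.rpow_le_rpow_of_exponent_le hmax (by nlinarith)
      exact (Nat.cast_le.2 hle).trans (hle'.trans
        (mul_le_mul (by linarith) hexp (by positivity) (by linarith)))
  · refine ⟨_, _, .branchFalse ?_ (.branchFalse ?_ (.natStore _ _ _ _)), ?_, ?_, hsmall _ ?_⟩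
    · simp [Test.Holds, NExpr.eval, i1, hk]
    · simpa [Test.Holds, NExpr.eval, i0, i1] using hkn
    · rintro ⟨S, hS, _⟩
      have := Finset.card_le_univ S
      rw [Fintype.card_fin] at this
      omega
    · simp [output, Memory.setNat_nat, NExpr.eval]
    · simp [Test.cost, NExpr.cost]

end Packing

/-! ### Balls and cubes -/

namespace Packing

open RealRAM

/-- `a < b` or `a ≤ b`. -/
def Cmp (strict : Bool) (a b : ℝ) : Prop := if strict then a < b else a ≤ b

def cmpTest (strict : Bool) (e f : RExpr) : Test := if strict then .realLT e f else .realLE e f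

theorem holds_cmpTest (strict : Bool) (e f : RExpr) (s : Memory) :
    (cmpTest strict e f).Holds s ↔ Cmp strict (e.eval s) (f.eval s) := by
  cases strict <;> rfl

theorem below_cmpTest (strict : Bool) {D : ℕ} {e f : RExpr} (he : e.Below D) (hf : f.Below D) :
    (cmpTest strict e f).Below D := by
  cases strict <;> exact ⟨he, hf⟩

theorem Cmp.le {strict : Bool} {a b : ℝ} (h : Cmp strict a b) : a ≤ b := by
  cases strict
  · exact h
  · exact le_of_lt h

theorem Cmp.of_lt {strict : Bool} {a b : ℝ} (h : a < b) : Cmp strict a b := by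
  cases strict
  · exact le_of_lt h
  · exact h

/-- Squared distances suffice for comparison with the diameter, so no square root is needed. -/
def distSqE (e f : NExpr) : ℕ → RExpr
  | 0 => .lit 0
  | m + 1 => .add (distSqE e f m)
      (.mul (.sub (.load m e) (.load m f)) (.sub (.load m e) (.load m f)))

theorem distSqE_eval (s : Memory) (e f : NExpr) (m : ℕ) : (distSqE e f m).eval s =
    ∑ j ∈ Finset.range m, (s.real j (e.eval s) - s.real j (f.eval s)) ^ 2 := by
  induction m with
  | zero => simp [distSqE, RExpr.eval]
  | succ m ih => rw [Finset.sum_range_succ, ← ih]; simp [distSqE, RExpr.eval, sq]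

theorem below_distSqE {D : ℕ} {e f : NExpr} (he : e.Below D) (hf : f.Below D) (m : ℕ) :
    (distSqE e f m).Below D := by
  induction m with
  | zero => trivial
  | succ m ih => exact ⟨ih, ⟨he, hf⟩, ⟨he, hf⟩⟩

/-- Conflict between unit balls. -/
def ballConflict {d : ℕ} (hd : 2 ≤ d) (strict : Bool) : Conflict d where
  rel y z := Cmp strict (∑ j ∈ Finset.range d, (y j - z j) ^ 2) 4
  test e f := cmpTest strict (distSqE e f d) (.lit 4)
  holds s e f := by rw [holds_cmpTest, distSqE_eval]; norm_num [RExpr.eval]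
  below D e f he hf := below_cmpTest strict (below_distSqE he hf d) trivial
  symm y z h := by
    have : ∑ j ∈ Finset.range d, (z j - y j) ^ 2 = ∑ j ∈ Finset.range d, (y j - z j) ^ 2 :=
      Finset.sum_congr rfl fun j _ => by ring
    rwa [this]
  close y z h j hj := by
    have h1 := Finset.single_le_sum (f := fun j => (y j - z j) ^ 2) (fun j _ => sq_nonneg _)
      (Finset.mem_range.2 hj)
    exact abs_le_of_sq_le_sq (h1.trans (h.le.trans (by norm_num))) (by norm_num)
  -- The squared distance is at most `d * (1 / d) ^ 2 = 1 / d`, which is below `4`.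
  separated y z h := by
    have hd' : (2 : ℝ) ≤ d := by exact_mod_cast hd
    have h1 : ∑ j ∈ Finset.range d, (y j - z j) ^ 2 ≤ ∑ j ∈ Finset.range d, (1 / (d : ℝ)) ^ 2 :=
      Finset.sum_le_sum fun j hj => by
        rw [← sq_abs]
        exact pow_le_pow_left₀ (abs_nonneg _) (h j (Finset.mem_range.1 hj)) 2
    refine Cmp.of_lt (h1.trans_lt ?_)
    rw [Finset.sum_const, Finset.card_range, nsmul_eq_mul]
    have h2 : (d : ℝ) * (1 / d) ^ 2 = 1 / d := by field_simp
    rw [h2, div_lt_iff₀ (by positivity)]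
    linarith

/-- Conflict between cubes of side length `1`. -/
def cubeConflict {d : ℕ} (hd : 2 ≤ d) (strict : Bool) : Conflict d where
  rel y z := ∀ j < d, Cmp strict (y j - z j) 1 ∧ Cmp strict (z j - y j) 1
  test e f := .forall (fun j => .and (cmpTest strict (.sub (.load j e) (.load j f)) (.lit 1))
    (cmpTest strict (.sub (.load j f) (.load j e)) (.lit 1))) d
  holds s e f := by
    simp only [Test.holds_forall, Test.Holds, holds_cmpTest, RExpr.eval, Rat.cast_one]
  below D e f he hf := by
    refine Test.below_forall (fun j => ?_) d
    exact ⟨below_cmpTest strict ⟨he, hf⟩ trivial, below_cmpTest strict ⟨hf, he⟩ trivial⟩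
  symm y z h j hj := (h j hj).symm
  close y z h j hj := by
    have h1 := (h j hj).1.le
    have h2 := (h j hj).2.le
    rw [abs_le]
    constructor <;> linarith
  separated y z h j hj := by
    have hd' : (2 : ℝ) ≤ d := by exact_mod_cast hd
    have h1 : 1 / (d : ℝ) < 1 := by rw [div_lt_iff₀ (by positivity)]; linarith
    have h2 := abs_le.1 (h j hj)
    exact ⟨.of_lt (by linarith), .of_lt (by linarith)⟩

theorem sum_sq_eq {d : ℕ} {x y : EuclideanSpace ℝ (Fin d)} {u v : ℕ → ℝ}
    (hu : ∀ j : Fin d, u j = x j) (hv : ∀ j : Fin d, v j = y j) :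
    ∑ j ∈ Finset.range d, (u j - v j) ^ 2 = dist x y ^ 2 := by
  rw [← Fin.sum_univ_eq_sum_range (fun j => (u j - v j) ^ 2), EuclideanSpace.dist_eq,
    Real.sq_sqrt (Finset.sum_nonneg fun _ _ => sq_nonneg _)]
  exact Finset.sum_congr rfl fun j _ => by rw [hu, hv, Real.dist_eq, sq_abs]

theorem describes_ball {d : ℕ} (hd : 2 ≤ d) :
    (ballConflict hd true).Describes fun x => Metric.ball x 1 := by
  intro x y u v hu hv
  have h : (ballConflict hd true).rel u v ↔ dist x y ^ 2 < 4 := by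
    rw [← sum_sq_eq hu hv]; rfl
  rw [disjoint_ball_ball_iff one_pos one_pos, h, not_lt]
  have h0 := dist_nonneg (x := x) (y := y)
  constructor <;> intro h <;> nlinarith

theorem describes_closedBall {d : ℕ} (hd : 2 ≤ d) :
    (ballConflict hd false).Describes fun x => Metric.closedBall x 1 := by
  intro x y u v hu hv
  have h : (ballConflict hd false).rel u v ↔ dist x y ^ 2 ≤ 4 := by
    rw [← sum_sq_eq hu hv]; rfl
  rw [disjoint_closedBall_closedBall_iff zero_le_one zero_le_one, h, not_le]
  have h0 := dist_nonneg (x := x) (y := y)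
  constructor <;> intro h <;> nlinarith

theorem describes_cube {d : ℕ} (hd : 2 ≤ d) (strict : Bool) :
    (cubeConflict hd strict).Describes
      fun x => {z | ∀ j, Cmp strict |z j - x j| (1 / 2)} := by
  intro x y u v hu hv
  rw [← not_iff_not, not_not, Set.not_disjoint_iff]
  constructor
  · rintro ⟨z, hzx, hzy⟩ j hj
    have h1 := hzx ⟨j, hj⟩
    have h2 := hzy ⟨j, hj⟩
    rw [show u j = x ⟨j, hj⟩ from hu ⟨j, hj⟩, show v j = y ⟨j, hj⟩ from hv ⟨j, hj⟩]
    cases strict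
    · have h1 := abs_le.1 (show |z ⟨j, hj⟩ - x ⟨j, hj⟩| ≤ 1 / 2 from h1)
      have h2 := abs_le.1 (show |z ⟨j, hj⟩ - y ⟨j, hj⟩| ≤ 1 / 2 from h2)
      simp only [Cmp, Bool.false_eq_true, if_false]
      constructor <;> linarith
    · have h1 := abs_lt.1 (show |z ⟨j, hj⟩ - x ⟨j, hj⟩| < 1 / 2 from h1)
      have h2 := abs_lt.1 (show |z ⟨j, hj⟩ - y ⟨j, hj⟩| < 1 / 2 from h2)
      simp only [Cmp, if_true]
      constructor <;> linarith
  · intro h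
    -- The midpoint of the two centres lies in both cubes.
    refine ⟨WithLp.toLp 2 fun j => (x j + y j) / 2, fun j => ?_, fun j => ?_⟩
    all_goals
      obtain ⟨h1, h2⟩ := h j j.2
      rw [hu, hv] at h1 h2
      cases strict
    · simp only [Cmp, Bool.false_eq_true, if_false] at h1 h2 ⊢
      rw [abs_le]; constructor <;> linarith
    · simp only [Cmp, if_true] at h1 h2 ⊢
      rw [abs_lt]; constructor <;> linarith
    · simp only [Cmp, Bool.false_eq_true, if_false] at h1 h2 ⊢
      rw [abs_le]; constructor <;> linarith
    · simp only [Cmp, if_true] at h1 h2 ⊢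
      rw [abs_lt]; constructor <;> linarith

end Packing

theorem mainTheorem8 (d : ℕ) (hd : 2 ≤ d)
    (B : EuclideanSpace ℝ (Fin d) → Set (EuclideanSpace ℝ (Fin d)))
    (hB : (B = fun x => Metric.ball x 1) ∨ (B = fun x => Metric.closedBall x 1) ∨
      B = Packing.openCube ∨ B = Packing.closedCube) :
    ∃ (P : RealRAM.Program) (C : ℝ),
      ∀ (n k : ℕ) (c : Fin n → EuclideanSpace ℝ (Fin d)),
        ∃ (s : RealRAM.Memory) (t : ℕ),
          RealRAM.Runs P (Packing.input c k) s t ∧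
          (Packing.HasPacking B c k → Packing.output s = 1) ∧
          (¬ Packing.HasPacking B c k → Packing.output s = 0) ∧
          (t : ℝ) ≤ C * ((max n 1 : ℕ) : ℝ) ^ (C * (k : ℝ) ^ (1 - 1 / (d : ℝ))) := by
  rcases hB with rfl | rfl | rfl | rfl
  · exact Packing.exists_program hd _ _ (Packing.describes_ball hd)
  · exact Packing.exists_program hd _ _ (Packing.describes_closedBall hd)
  · exact Packing.exists_program hd _ _ (Packing.describes_cube hd true)
  · exact Packing.exists_program hd _ _ (Packing.describes_cube hd false)
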